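/- Let $X$ be a compact (Hausdorff) complex manifold of complex dimension $3$ with a Hermitian metric, and let $\omega$ be its associated form, a smooth positive real $(1,1)$-form. Put $V_\omega=\int_X\omega^3$, and for a smooth real function $\varphi$ on $X$ put $\omega_\varphi=\omega+\sqrt{-1}\,\partial\bar\partial\varphi$. Let $\mathcal P_\omega$ be the set of smooth real functions $\varphi$ on $X$ with $\omega_\varphi>0$. For $\varphi',\varphi''\in\mathcal P_\omega$, a smooth path in $\mathcal P_\omega$ from $\varphi'$ to $\varphi''$ is a family $\Phi=(\varphi_t)_{0\le t\le1}$ of elements of $\mathcal P_\omega$, smooth on $[0,1]\times X$, with $\varphi_0=\varphi'$ and $\varphi_1=\varphi''$; write $\dot\varphi_t=\partial\varphi_t/\partial t$. For a constant $\varepsilon$ put $$\begin{aligned}\mathcal L^{\varepsilon}_\omega(\Phi)={}&\frac1{V_\omega}\int_0^1\!\int_X\dot\varphi_t\,\omega_{\varphi_t}^3\,dt-\frac1{V_\omega}\int_0^1\!\int_X3\sqrt{-1}\,\partial\omega\wedge(\bar\partial\dot\varphi_t\cdot\varphi_t)\wedge\omega_{\varphi_t}\,dt\\&+\frac1{V_\omega}\int_0^1\!\int_X3\sqrt{-1}\,\bar\partial\omega\wedge(\partial\dot\varphi_t\cdot\varphi_t)\wedge\omega_{\varphi_t}\,dt\\&+\frac{\varepsilon}{V_\omega}\int_0^1\!\int_X\partial\varphi_t\wedge\bar\partial\varphi_t\wedge\partial\omega\wedge\bar\partial\dot\varphi_t\,dt+\frac{\varepsilon}{V_\omega}\int_0^1\!\int_X\bar\partial\varphi_t\wedge\partial\varphi_t\wedge\bar\partial\omega\wedge\partial\dot\varphi_t\,dt.\end{aligned}$$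 Let $\varphi\in\mathcal P_\omega$ and $$\begin{aligned}F_\omega(\varphi)={}&\frac1{4V_\omega}\sum_{i=0}^3\int_X\varphi\,\omega_\varphi^i\wedge\omega^{3-i}-\sum_{i=0}^1\frac{i+1}{2V_\omega}\int_X\varphi\,\omega_\varphi^i\wedge\omega^{1-i}\wedge\sqrt{-1}\,\partial\omega\wedge\bar\partial\varphi\\&+\sum_{i=0}^1\frac{i+1}{2V_\omega}\int_X\varphi\,\omega_\varphi^i\wedge\omega^{1-i}\wedge\sqrt{-1}\,\bar\partial\omega\wedge\partial\varphi.\end{aligned}$$ Then: 1. The Mabuchi functional $\mathcal L^{\rm M}_\omega(\varphi)=\mathcal L^{\rm M}_\omega(0,\varphi)$, i.e. $\mathcal L^{1}_\omega(\Phi)$ for any smooth path $\Phi$ in $\mathcal P_\omega$ from $0$ to $\varphi$, is given by $F_\omega(\varphi)$: for every such path, $\mathcal L^{1}_\omega(\Phi)=F_\omega(\varphi)$. 2. The path $(t\varphi)_{0\le t\le1}$ is a smooth path in $\mathcal P_\omega$ from $0$ to $\varphi$, and along it $\mathcal L^{-1}_\omega$ also takes the value $F_\omega(\varphi)$. -/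

import Mathlib

open scoped Manifold ContDiff

noncomputable section

/-- The model space `ℂ³` of a complex three-fold. -/
abbrev C3 : Type := Fin 3 → ℂ

/-- Multiplication by `√-1` on `ℂ³`, as a real-linear map (the complex structure `J`). -/
def mulI : C3 →L[ℝ] C3 := ((Complex.I • ContinuousLinearMap.id ℂ C3)).restrictScalars ℝ

/-! ### Multilinear algebra: the wedge product of complex-valued real-alternating forms -/

theorem MultilinearMap.continuous_C3 {k : ℕ}
    (f : MultilinearMap ℝ (fun _ : Fin k => C3) ℂ) : Continuous f := by
  classical
  let b := Module.finBasis ℝ C3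
  have h : ∀ v : Fin k → C3,
      f v = ∑ r : Fin k → Fin (Module.finrank ℝ C3),
        (∏ i, b.coord (r i) (v i)) • f (fun i => b (r i)) := fun v => by
    have hv : v = fun i => ∑ j, b.coord j (v i) • b j := by
      funext i; exact (b.sum_repr (v i)).symm
    conv_lhs => rw [hv]
    rw [f.map_sum]
    exact Finset.sum_congr rfl fun r _ => f.map_smul_univ _ _
  rw [show (f : (Fin k → C3) → ℂ) = _ from funext h]
  have hc : ∀ j, Continuous (b.coord j) := fun j => (b.coord j).continuous_of_finiteDimensional
  exact continuous_finsetSum _ fun r _ =>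
    (continuous_finsetProd _ fun i _ => (hc (r i)).comp (continuous_apply i)).smul
      continuous_const

/-- The wedge product of alternating forms, the sum over shuffles of signed products:
`(a ∧ b)(v₁,…,v_{k+l}) = ∑ sign σ a(v_{σ(1)},…,v_{σ(k)}) b(v_{σ(k+1)},…,v_{σ(k+l)})`. -/
def wedgeAt {k l : ℕ} (a : C3 [⋀^Fin k]→L[ℝ] ℂ) (b : C3 [⋀^Fin l]→L[ℝ] ℂ) :
    C3 [⋀^Fin (k + l)]→L[ℝ] ℂ :=
  let m : C3 [⋀^Fin (k + l)]→ₗ[ℝ] ℂ :=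
    ((LinearMap.mul' ℝ ℂ).compAlternatingMap
      (a.toAlternatingMap.domCoprod b.toAlternatingMap)).domDomCongr finSumFinEquiv
  { m with cont := m.toMultilinearMap.continuous_C3 }

/-! ### `∂` and `∂̄` on open sets of `ℂ³`

If `a = ∑ a_{IJ} dz_I ∧ dz̄_J`, then `∂a = ∑ ∂a_{IJ} ∧ dz_I ∧ dz̄_J`: the differential of the
coefficients is replaced by its complex-linear part, and the result is alternated with the
same normalisation as in the exterior derivative `extDeriv`. Thus `∂ + ∂̄ = d`. -/

/-- `∂` of a `k`-form on `ℂ³`; `v ↦ ½ (D_v a - √-1 D_{√-1 v} a)` is the `(1,0)`-part of `Da`. -/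
def delModel {k : ℕ} (a : C3 → C3 [⋀^Fin k]→L[ℝ] ℂ) (z : C3) : C3 [⋀^Fin (k + 1)]→L[ℝ] ℂ :=
  .alternatizeUncurryFin
    ((1 / 2 : ℂ) • (fderiv ℝ a z - Complex.I • (fderiv ℝ a z).comp mulI))

/-- `∂̄` of a `k`-form on `ℂ³`; `v ↦ ½ (D_v a + √-1 D_{√-1 v} a)` is the `(0,1)`-part of `Da`. -/
def delbarModel {k : ℕ} (a : C3 → C3 [⋀^Fin k]→L[ℝ] ℂ) (z : C3) : C3 [⋀^Fin (k + 1)]→L[ℝ] ℂ :=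
  .alternatizeUncurryFin
    ((1 / 2 : ℂ) • (fderiv ℝ a z + Complex.I • (fderiv ℝ a z).comp mulI))

/-- The real frame `e₁, √-1 e₁, e₂, √-1 e₂, e₃, √-1 e₃` of `ℂ³`, in the standard orientation. -/
def stdFrame : Fin 6 → C3 :=
  ![Pi.single 0 1, Pi.single 0 Complex.I, Pi.single 1 1, Pi.single 1 Complex.I,
    Pi.single 2 1, Pi.single 2 Complex.I]

/-! ### Complex-valued differential forms on a complex three-fold -/

/-- A complex-valued differential `k`-form on `X` (no regularity): at every `x` an alternating
real-multilinear form on the tangent space at `x`, which, as everywhere in Mathlib, is the model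
space `ℂ³` through the preferred chart `chartAt C3 x` at `x`. -/
abbrev CForm (X : Type*) (k : ℕ) : Type _ := X → C3 [⋀^Fin k]→L[ℝ] ℂ

namespace CForm

/-- A function as a `0`-form. -/
def ofFun {X : Type*} (f : X → ℂ) : CForm X 0 :=
  fun x => ContinuousAlternatingMap.constOfIsEmpty ℝ C3 (Fin 0) (f x)

/-- The wedge product of forms. -/
def wedge {X : Type*} {k l : ℕ} (α : CForm X k) (β : CForm X l) : CForm X (k + l) :=
  fun x => wedgeAt (α x) (β x)

/-- The product of a real function and a form. -/
def fmul {X : Type*} {k : ℕ} (f : X → ℝ) (α : CForm X k) : CForm X k :=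
  fun x => (f x : ℂ) • α x

/-- The wedge power `α^i` of a `2`-form. -/
def wpow {X : Type*} (α : CForm X 2) : (i : ℕ) → CForm X (2 * i)
  | 0 => ofFun fun _ => 1
  | i + 1 => wedge (wpow α i) α

variable {X : Type*} [TopologicalSpace X] [ChartedSpace C3 X] {k : ℕ}

/-- The expression of a form in the chart `chartAt C3 c`: the form on `(chartAt C3 c).target`
which is the pullback of `α` under the inverse of this chart. At `z`, with `y` the corresponding
point of `X`, it is `α y` pulled back by the derivative of the change of coordinates from the
chart at `c` to the chart at `y`. -/
def inChart (α : CForm X k) (c : X) (z : C3) : C3 [⋀^Fin k]→L[ℝ] ℂ :=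
  (α ((chartAt C3 c).symm z)).compContinuousLinearMap
    (fderiv ℝ (chartAt C3 ((chartAt C3 c).symm z) ∘ (chartAt C3 c).symm) z)

/-- A form is smooth if its expressions in charts are. -/
def IsSmooth (α : CForm X k) : Prop :=
  ∀ c : X, ContDiffOn ℝ ∞ (α.inChart c) (chartAt C3 c).target

/-- The operator `∂` on forms on a complex manifold, computed in holomorphic coordinates. -/
def del (α : CForm X k) : CForm X (k + 1) :=
  fun x => delModel (α.inChart x) (chartAt C3 x x)

/-- The operator `∂̄` on forms on a complex manifold, computed in holomorphic coordinates. -/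
def delbar (α : CForm X k) : CForm X (k + 1) :=
  fun x => delbarModel (α.inChart x) (chartAt C3 x x)

/-- `α` is a positive real `(1,1)`-form: it is real-valued, `J`-invariant, and `α(v, Jv) > 0` for
`v ≠ 0`. Equivalently `α = √-1 ∑ h_{jk} dz_j ∧ dz̄_k` with `(h_{jk})` Hermitian positive definite,
i.e. `α` is the associated form of a Hermitian metric. -/
def IsPositive (α : CForm X 2) : Prop :=
  ∀ x : X, (∀ v w : C3, (α x ![v, w]).im = 0) ∧
    (∀ v w : C3, α x ![mulI v, mulI w] = α x ![v, w]) ∧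
    ∀ v : C3, v ≠ 0 → 0 < (α x ![v, mulI v]).re

end CForm

/-- The wedge product of forms. -/
infixl:70 " ⋏ " => CForm.wedge

/-! ### Integration -/

/-- The real smooth manifold underlying a complex manifold. -/
theorem isManifold_real (X : Type*) [TopologicalSpace X] [ChartedSpace C3 X]
    [IsManifold 𝓘(ℂ, C3) ω X] : IsManifold 𝓘(ℝ, C3) ∞ X := by
  refine isManifold_of_contDiffOn _ _ _ fun e e' he he' => ?_
  have h := StructureGroupoid.compatible (contDiffGroupoid ω 𝓘(ℂ, C3)) he he'
  rw [contDiffGroupoid, mem_groupoid_of_pregroupoid] at h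
  have h1 : ContDiffOn ℂ ω _ _ := h.1
  exact (h1.restrict_scalars ℝ).of_le le_top

section Integral

variable (X : Type*) [TopologicalSpace X] [ChartedSpace C3 X] [IsManifold 𝓘(ℂ, C3) ω X]
  [T2Space X] [CompactSpace X]

/-- A smooth partition of unity `(ρ_c)` on `X` in which the support of `ρ_c` lies in the domain of
the chart at `c`. -/
def chartPartition : SmoothPartitionOfUnity X 𝓘(ℝ, C3) X Set.univ :=
  haveI := isManifold_real X
  Classical.choose (SmoothPartitionOfUnity.exists_isSubordinate_chartAt_source 𝓘(ℝ, C3) X)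

theorem chartPartition_isSubordinate :
    (chartPartition X).IsSubordinate fun c => (chartAt C3 c).source :=
  haveI := isManifold_real X
  Classical.choose_spec (SmoothPartitionOfUnity.exists_isSubordinate_chartAt_source 𝓘(ℝ, C3) X)

variable {X}

/-- The integral over `X` (with its complex orientation) of a form `α` of top degree `6`:
`∑_c ∫ ρ_c α`, where the form `ρ_c α`, supported in the domain of the chart at `c`, is integrated
in this chart. The degree is written as `k` with `k = 6`, to avoid casts. -/
def CForm.integral {k : ℕ} (α : CForm X k) (hk : k = 6 := by omega) : ℂ :=
  ∑ᶠ c : X, ∫ z in (chartAt C3 c).target,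
    (chartPartition X c ((chartAt C3 c).symm z) : ℂ) *
      α.inChart c z (fun j => stdFrame (Fin.cast hk j))

end Integral

/-! ### Potentials, paths, and the Mabuchi functional

Throughout, `Ω` is the associated form of a Hermitian metric. -/

section Mabuchi

variable {X : Type*} [TopologicalSpace X] [ChartedSpace C3 X]

/-- `∂f` for a real function `f`. -/
def del₀ (f : X → ℝ) : CForm X 1 := (CForm.ofFun fun x => (f x : ℂ)).del

/-- `∂̄f` for a real function `f`. -/
def delbar₀ (f : X → ℝ) : CForm X 1 := (CForm.ofFun fun x => (f x : ℂ)).delbar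

/-- `Ω_φ = Ω + √-1 ∂∂̄φ`. -/
def deform (Ω : CForm X 2) (φ : X → ℝ) : CForm X 2 := Ω + Complex.I • (delbar₀ φ).del

/-- The space `𝒫_Ω` of smooth real functions `φ` with `Ω_φ > 0`. -/
def potentials (Ω : CForm X 2) : Set (X → ℝ) :=
  {φ | ContMDiff 𝓘(ℝ, C3) 𝓘(ℝ, ℝ) ∞ φ ∧ (deform Ω φ).IsPositive}

/-- `Φ = (Φ_t)_{0 ≤ t ≤ 1}` is a smooth path in `𝒫_Ω` from `φ'` to `φ''`: it is smooth on
`[0,1] × X`. (Values for `t` outside `[0,1]` are irrelevant.) -/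
def IsSmoothPath (Ω : CForm X 2) (φ' φ'' : X → ℝ) (Φ : ℝ → X → ℝ) : Prop :=
  ContMDiffOn (𝓘(ℝ, ℝ).prod 𝓘(ℝ, C3)) 𝓘(ℝ, ℝ) ∞ (fun p : ℝ × X => Φ p.1 p.2)
      (Set.Icc 0 1 ×ˢ Set.univ) ∧
    Φ 0 = φ' ∧ Φ 1 = φ'' ∧ ∀ t ∈ Set.Icc (0 : ℝ) 1, Φ t ∈ potentials Ω

/-- The time derivative `∂Φ_t/∂t` of a path, one-sided at the ends of `[0,1]`. -/
def pathDeriv (Φ : ℝ → X → ℝ) (t : ℝ) (x : X) : ℝ :=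
  derivWithin (fun s => Φ s x) (Set.Icc 0 1) t

variable [IsManifold 𝓘(ℂ, C3) ω X] [T2Space X] [CompactSpace X]

/-- `V_Ω = ∫_X Ω³`. -/
def totalVolume (Ω : CForm X 2) : ℂ := (Ω.wpow 3).integral

/-- The Mabuchi functional along a path `Φ`, with coefficient `ε` in front of the last two terms:
```
1/V ∫₀¹∫ Φ̇ Ω_Φ³ - 1/V ∫₀¹∫ 3√-1 ∂Ω ∧ (∂̄Φ̇ · Φ) ∧ Ω_Φ + 1/V ∫₀¹∫ 3√-1 ∂̄Ω ∧ (∂Φ̇ · Φ) ∧ Ω_Φ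
  + ε/V ∫₀¹∫ ∂Φ ∧ ∂̄Φ ∧ ∂Ω ∧ ∂̄Φ̇ + ε/V ∫₀¹∫ ∂̄Φ ∧ ∂Φ ∧ ∂̄Ω ∧ ∂Φ̇
```
-/
def mabuchiAlong (ε : ℂ) (Ω : CForm X 2) (Φ : ℝ → X → ℝ) : ℂ :=
  (totalVolume Ω)⁻¹ *
      (∫ t in (0 : ℝ)..1, (((deform Ω (Φ t)).wpow 3).fmul (pathDeriv Φ t)).integral)
    - (totalVolume Ω)⁻¹ *
      (∫ t in (0 : ℝ)..1,
        ((3 * Complex.I) •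
          (Ω.del ⋏ (delbar₀ (pathDeriv Φ t)).fmul (Φ t) ⋏ deform Ω (Φ t))).integral)
    + (totalVolume Ω)⁻¹ *
      (∫ t in (0 : ℝ)..1,
        ((3 * Complex.I) •
          (Ω.delbar ⋏ (del₀ (pathDeriv Φ t)).fmul (Φ t) ⋏ deform Ω (Φ t))).integral)
    + ε * (totalVolume Ω)⁻¹ *
      (∫ t in (0 : ℝ)..1,
        (del₀ (Φ t) ⋏ delbar₀ (Φ t) ⋏ Ω.del ⋏ delbar₀ (pathDeriv Φ t)).integral)
    + ε * (totalVolume Ω)⁻¹ *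
      (∫ t in (0 : ℝ)..1,
        (delbar₀ (Φ t) ⋏ del₀ (Φ t) ⋏ Ω.delbar ⋏ del₀ (pathDeriv Φ t)).integral)

/-- The closed formula
```
1/(4V) ∑_{i=0}^3 ∫ φ Ω_φ^i ∧ Ω^{3-i}
  - ∑_{i=0}^1 (i+1)/(2V) ∫ φ Ω_φ^i ∧ Ω^{1-i} ∧ √-1 ∂Ω ∧ ∂̄φ
  + ∑_{i=0}^1 (i+1)/(2V) ∫ φ Ω_φ^i ∧ Ω^{1-i} ∧ √-1 ∂̄Ω ∧ ∂φ
``` -/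
def mabuchiFormula (Ω : CForm X 2) (φ : X → ℝ) : ℂ :=
  1 / (4 * totalVolume Ω) *
      ∑ i : Fin 4, (((deform Ω φ).wpow i ⋏ Ω.wpow (3 - (i : ℕ))).fmul φ).integral
    - ∑ i : Fin 2, ((i : ℕ) + 1) / (2 * totalVolume Ω) *
        (((deform Ω φ).wpow i ⋏ Ω.wpow (1 - (i : ℕ)) ⋏ (Complex.I • Ω.del) ⋏ delbar₀ φ).fmul φ).integral
    + ∑ i : Fin 2, ((i : ℕ) + 1) / (2 * totalVolume Ω) *
        (((deform Ω φ).wpow i ⋏ Ω.wpow (1 - (i : ℕ)) ⋏ (Complex.I • Ω.delbar) ⋏ del₀ φ).fmul φ).integral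

end Mabuchi

end

/-! The closed formula is a primitive of the integrand of the functional. Write `energy` for `4V`
times the closed formula and `integrand` for the integrand with `ε = 1`, before division by `V`.
Along any smooth path, `d/dt energy(φ_t)` equals `4 · integrand(φ_t, φ̇_t)` (`isPrimitive_energy`).
Since `energy` vanishes at `0`, every summand having a factor `φ`, integrating over `[0,1]` gives
the first claim, whatever the path.

The derivative formula holds because, at each time, the two sides differ by the integral of an
explicit combination of fifteen forms `∂(…)` and `∂̄(…)`, which Stokes' theorem (`integral_dOp`)
kills. That the difference has this shape is pure algebra (`energy_deriv_sub_eq`): it follows from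
the graded Leibniz rule, from `∂∂ = 0`, `∂̄∂̄ = 0`, `∂̄∂ = -∂∂̄`, and from the fact that even forms
are central while odd forms anticommute.

For the second claim, on the segment `tφ` one has `∂̄φ_t = t ∂̄φ = t ∂̄φ̇_t`, so each `ε`-term
contains the square of a `1`-form and vanishes (`mabuchiAlong_linear`). Hence `ε = -1` and `ε = 1`
give the same value there. The segment stays in the space of potentials because `Ω_{tφ} = (1 - t)Ω +
tΩ_φ`.

Two devices carry the bookkeeping. Forms of all degrees are embedded in one exterior algebra
(`symb`, `symbol`), so that products of forms become products in a ring and equalities between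
degrees disappear. And `∂`, `∂̄` are the cases `c = -√-1`, `c = √-1` of the operator `½(d + c d_J)`
(`dModel`, `dOp`), whose Leibniz rule, anticommutation, naturality under holomorphic maps and
Stokes' theorem are proved once for all `c`. -/

noncomputable section

/-! ### The symbol of an alternating form in the exterior algebra -/

/-- The exterior algebra of the complexified cotangent space. -/
abbrev ExtAlg : Type := ExteriorAlgebra ℂ (Fin 6 → ℂ)

/-- The generator of the exterior algebra dual to the `j`-th vector of the standard frame. -/
def covec (j : Fin 6) : ExtAlg := ExteriorAlgebra.ι ℂ (Pi.single j 1)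

/-- The product of the generators `covec (r i)`. -/
def covecs {k : ℕ} (r : Fin k → Fin 6) : ExtAlg :=
  ExteriorAlgebra.ιMulti ℂ k fun i => (Pi.single (r i) 1 : Fin 6 → ℂ)

theorem covecs_comp_perm {k : ℕ} (r : Fin k → Fin 6) (σ : Equiv.Perm (Fin k)) :
    covecs (r ∘ σ) = Equiv.Perm.sign σ • covecs r :=
  (ExteriorAlgebra.ιMulti ℂ k).map_perm (fun i => (Pi.single (r i) 1 : Fin 6 → ℂ)) σ

theorem covecs_append {k l : ℕ} (r : Fin k → Fin 6) (s : Fin l → Fin 6) :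
    covecs (Fin.append r s) = covecs r * covecs s := by
  rw [covecs, covecs, covecs, ExteriorAlgebra.ιMulti_mul_ιMulti]
  congr 1
  funext i
  refine Fin.addCases (fun i => ?_) (fun i => ?_) i <;> simp

theorem covecs_zero (r : Fin 0 → Fin 6) : covecs r = 1 := by
  simp [covecs]

theorem covecs_cons {k : ℕ} (j : Fin 6) (r : Fin k → Fin 6) :
    covecs (Fin.cons j r : Fin (k + 1) → Fin 6) = covec j * covecs r := by
  simp [covecs, covec, ExteriorAlgebra.ιMulti_succ_apply, Matrix.vecTail, Function.comp_def]

theorem covec_mul_covec (i j : Fin 6) : covec i * covec j = -(covec j * covec i) :=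
  eq_neg_of_add_eq_zero_left (ExteriorAlgebra.ι_add_mul_swap _ _)

theorem covec_mul_covecs (j : Fin 6) {k : ℕ} (r : Fin k → Fin 6) :
    covec j * covecs r = (-1 : ℂ) ^ k • (covecs r * covec j) := by
  induction k with
  | zero => simp [covecs_zero]
  | succ k ih =>
    obtain ⟨i, s, rfl⟩ : ∃ i s, r = Fin.cons i s := ⟨r 0, Fin.tail r, (Fin.cons_self_tail r).symm⟩
    rw [covecs_cons, ← mul_assoc, covec_mul_covec, neg_mul, mul_assoc, ih, mul_smul_comm, pow_succ,
      mul_assoc]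
    simp

theorem covecs_mul_covecs {k l : ℕ} (r : Fin k → Fin 6) (s : Fin l → Fin 6) :
    covecs r * covecs s = (-1 : ℂ) ^ (k * l) • (covecs s * covecs r) := by
  induction k with
  | zero => simp [covecs_zero]
  | succ k ih =>
    obtain ⟨i, t, rfl⟩ : ∃ i t, r = Fin.cons i t := ⟨r 0, Fin.tail r, (Fin.cons_self_tail r).symm⟩
    rw [covecs_cons, mul_assoc, ih, mul_smul_comm, ← mul_assoc, covec_mul_covecs, smul_mul_assoc,
      smul_smul, mul_assoc, ← pow_add, add_mul, one_mul]

/-- An alternating form as an element of the exterior algebra. -/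
def symb {k : ℕ} : (C3 [⋀^Fin k]→L[ℝ] ℂ) →ₗ[ℂ] ExtAlg where
  -- Summing over all multi-indices, rather than increasing ones, counts each basis monomial `k!`
  -- times; the factor in front corrects this and no ordering has to be chosen.
  toFun a := (k.factorial : ℂ)⁻¹ • ∑ r : Fin k → Fin 6, a (stdFrame ∘ r) • covecs r
  map_add' a b := by simp [add_smul, Finset.sum_add_distrib]
  map_smul' c a := by
    simp only [ContinuousAlternatingMap.smul_apply, smul_assoc, RingHom.id_apply]
    rw [← Finset.smul_sum, smul_comm]

theorem symb_apply {k : ℕ} (a : C3 [⋀^Fin k]→L[ℝ] ℂ) :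
    symb a = (k.factorial : ℂ)⁻¹ • ∑ r : Fin k → Fin 6, a (stdFrame ∘ r) • covecs r := rfl

theorem symb_constOfIsEmpty (c : ℂ) :
    symb (ContinuousAlternatingMap.constOfIsEmpty ℝ C3 (Fin 0) c) = algebraMap ℂ ExtAlg c := by
  simp [symb_apply, covecs_zero, Algebra.algebraMap_eq_smul_one]

theorem symb_mul_symb {k l : ℕ} (a : C3 [⋀^Fin k]→L[ℝ] ℂ) (b : C3 [⋀^Fin l]→L[ℝ] ℂ) :
    symb a * symb b = (-1 : ℂ) ^ (k * l) • (symb b * symb a) := by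
  have h : ∀ (r : Fin k → Fin 6) (s : Fin l → Fin 6),
      a (stdFrame ∘ r) • covecs r * b (stdFrame ∘ s) • covecs s =
        (-1 : ℂ) ^ (k * l) • (b (stdFrame ∘ s) • covecs s * a (stdFrame ∘ r) • covecs r) := by
    intro r s
    rw [smul_mul_smul_comm, smul_mul_smul_comm, covecs_mul_covecs, smul_comm,
      mul_comm (a _)]
  rw [symb_apply, symb_apply, smul_mul_smul_comm, smul_mul_smul_comm, Finset.sum_mul_sum,
    Finset.sum_mul_sum, smul_comm, Finset.sum_comm, mul_comm (k.factorial : ℂ)⁻¹]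
  simp_rw [h, Finset.smul_sum]

/-- The sum over shuffles is traded for a sum over all permutations, which is easier to reindex:
each shuffle class contains `k! l!` permutations with equal contributions. -/
theorem wedgeAt_apply {k l : ℕ} (a : C3 [⋀^Fin k]→L[ℝ] ℂ) (b : C3 [⋀^Fin l]→L[ℝ] ℂ)
    (v : Fin (k + l) → C3) :
    wedgeAt a b v = ((k.factorial * l.factorial : ℕ) : ℂ)⁻¹ *
      ∑ σ : Equiv.Perm (Fin k ⊕ Fin l), (Equiv.Perm.sign σ : ℤ) *
        (a (fun i => v (finSumFinEquiv (σ (.inl i)))) *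
          b (fun i => v (finSumFinEquiv (σ (.inr i))))) := by
  have h := congrArg (fun f => LinearMap.mul' ℝ ℂ (f (v ∘ finSumFinEquiv)))
    (MultilinearMap.domCoprod_alternization_eq a.toAlternatingMap b.toAlternatingMap)
  simp only [MultilinearMap.alternatization_apply, map_sum, Fintype.card_fin,
    AlternatingMap.smul_apply, map_nsmul] at h
  have h0 : ((k.factorial * l.factorial : ℕ) : ℂ) ≠ 0 :=
    Nat.cast_ne_zero.2 (mul_ne_zero (Nat.factorial_ne_zero _) (Nat.factorial_ne_zero _))
  rw [eq_inv_mul_iff_mul_eq₀ h0, ← nsmul_eq_mul]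
  refine h.symm.trans (Finset.sum_congr rfl fun σ _ => ?_)
  rw [Units.smul_def, map_zsmul, zsmul_eq_mul]
  rfl

/-- After reindexing the multi-index by `σ`, the sign of `σ` cancels the sign from
`covecs_comp_perm`. All `(k + l)!` permutations therefore contribute the same product, and the
factorials match the normalisations of the three symbols. -/
theorem symb_wedgeAt {k l : ℕ} (a : C3 [⋀^Fin k]→L[ℝ] ℂ) (b : C3 [⋀^Fin l]→L[ℝ] ℂ) :
    symb (wedgeAt a b) = symb a * symb b := by
  have h0 : ((k + l).factorial : ℂ) ≠ 0 := Nat.cast_ne_zero.2 (Nat.factorial_ne_zero _)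
  have key : ∀ σ : Equiv.Perm (Fin k ⊕ Fin l),
      ∑ r : Fin (k + l) → Fin 6, ((Equiv.Perm.sign σ : ℤ) *
        (a (fun i => stdFrame (r (finSumFinEquiv (σ (.inl i))))) *
          b (fun i => stdFrame (r (finSumFinEquiv (σ (.inr i))))) : ℂ)) • covecs r =
      ∑ r : Fin (k + l) → Fin 6,
        (a (fun i => stdFrame (r (finSumFinEquiv (.inl i)))) *
          b (fun i => stdFrame (r (finSumFinEquiv (.inr i))))) • covecs r := by
    intro σ
    let τ : Equiv.Perm (Fin (k + l)) := (finSumFinEquiv.symm.trans σ).trans finSumFinEquiv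
    have hτ : Equiv.Perm.sign τ = Equiv.Perm.sign σ := Equiv.Perm.sign_symm_trans_trans _ _
    refine Fintype.sum_equiv (Equiv.arrowCongr τ.symm (Equiv.refl _)) _ _ fun r => ?_
    have hr : Equiv.arrowCongr τ.symm (Equiv.refl _) r = r ∘ τ := rfl
    rw [hr, covecs_comp_perm, hτ, Units.smul_def, ← Int.cast_smul_eq_zsmul ℂ, smul_smul, mul_comm]
    simp [τ]
  have key2 : ∑ r : Fin (k + l) → Fin 6,
        (a (fun i => stdFrame (r (finSumFinEquiv (.inl i)))) *
          b (fun i => stdFrame (r (finSumFinEquiv (.inr i))))) • covecs r =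
      (∑ r : Fin k → Fin 6, a (stdFrame ∘ r) • covecs r) *
        ∑ r : Fin l → Fin 6, b (stdFrame ∘ r) • covecs r := by
    rw [Finset.sum_mul_sum, ← Fintype.sum_prod_type']
    symm
    refine Fintype.sum_equiv (Fin.appendEquiv k l) _ _ fun r => ?_
    rw [smul_mul_smul_comm]
    simp [Fin.appendEquiv, covecs_append, Function.comp_def]
  rw [symb_apply, symb_apply, symb_apply, smul_mul_smul_comm, ← key2]
  simp_rw [wedgeAt_apply, mul_smul, ← Finset.smul_sum, Finset.sum_smul, Function.comp_apply]
  rw [Finset.sum_comm]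
  simp_rw [key, Finset.sum_const, Finset.card_univ, Fintype.card_perm, Fintype.card_sum,
    Fintype.card_fin, ← Nat.cast_smul_eq_nsmul ℂ, smul_smul]
  congr 1
  push_cast
  field_simp

/-- The real basis of `ℂ³` given by the standard frame. -/
def frameBasis : Module.Basis (Fin 6) ℝ C3 :=
  .ofEquivFun
    { toFun := fun z => ![(z 0).re, (z 0).im, (z 1).re, (z 1).im, (z 2).re, (z 2).im]
      invFun := fun x => ![⟨x 0, x 1⟩, ⟨x 2, x 3⟩, ⟨x 4, x 5⟩]
      map_add' := fun z w => by ext i; fin_cases i <;> rfl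
      map_smul' := fun c z => by ext i; fin_cases i <;> simp
      left_inv := fun z => by ext i; fin_cases i <;> rfl
      right_inv := fun x => by ext i; fin_cases i <;> rfl }

theorem frameBasis_apply (j : Fin 6) : frameBasis j = stdFrame j := by
  rw [frameBasis, Module.Basis.coe_ofEquivFun]
  funext i
  fin_cases j <;> fin_cases i <;> simp [stdFrame, Complex.ext_iff]

theorem coe_frameBasis : ⇑frameBasis = stdFrame := funext frameBasis_apply

theorem ext_stdFrame {k : ℕ} {a b : C3 [⋀^Fin k]→L[ℝ] ℂ}
    (h : ∀ s : Fin k → Fin 6, a (stdFrame ∘ s) = b (stdFrame ∘ s)) : a = b := by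
  refine ContinuousAlternatingMap.toAlternatingMap_injective ?_
  refine Module.Basis.ext_alternating frameBasis fun s _ => ?_
  simpa [frameBasis_apply, Function.comp_def] using h s

/-- The coefficient of an element of the exterior algebra at the multi-index `s`. -/
def coeffAt {k : ℕ} (s : Fin k → Fin 6) : ExtAlg →ₗ[ℂ] ℂ :=
  ExteriorAlgebra.liftAlternating fun i =>
    -- A functional on the whole exterior algebra needs a value in every degree; only degree `k`
    -- matters, where it is the minor formed from the columns `s`.
    if h : i = k then
      h ▸ (Matrix.detRowAlternating (R := ℂ) (n := Fin k)).compLinearMap (LinearMap.funLeft ℂ ℂ s)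
    else 0

theorem coeffAt_covecs {k : ℕ} (s r : Fin k → Fin 6) :
    coeffAt s (covecs r) =
      ∑ σ : Equiv.Perm (Fin k), (Equiv.Perm.sign σ : ℤ) * if r ∘ σ = s then (1 : ℂ) else 0 := by
  rw [coeffAt, covecs, ExteriorAlgebra.liftAlternating_apply_ιMulti, dif_pos rfl]
  change Matrix.det (Matrix.of fun i j => (Pi.single (r i) 1 : Fin 6 → ℂ) (s j)) = _
  rw [Matrix.det_apply]
  refine Finset.sum_congr rfl fun σ _ => ?_
  rw [Units.smul_def, zsmul_eq_mul]
  congr 1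
  split_ifs with h
  · exact Finset.prod_eq_one fun i _ => by simp [← h]
  · obtain ⟨i, hi⟩ := Function.ne_iff.1 h
    exact Finset.prod_eq_zero (Finset.mem_univ i) (Pi.single_eq_of_ne (Ne.symm hi) _)

/-- This recovers a form from its symbol, whence the injectivity of `symb`. For each permutation
only `r = s ∘ σ⁻¹` survives, its sign appears twice, and the `k!` equal contributions cancel the
normalisation. -/
theorem coeffAt_symb {k : ℕ} (s : Fin k → Fin 6) (a : C3 [⋀^Fin k]→L[ℝ] ℂ) :
    coeffAt s (symb a) = a (stdFrame ∘ s) := by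
  have h0 : (k.factorial : ℂ) ≠ 0 := Nat.cast_ne_zero.2 (Nat.factorial_ne_zero _)
  have key : ∀ σ : Equiv.Perm (Fin k), ∑ r : Fin k → Fin 6, a (stdFrame ∘ r) *
      ((Equiv.Perm.sign σ : ℤ) * if r ∘ σ = s then (1 : ℂ) else 0) = a (stdFrame ∘ s) := by
    intro σ
    rw [Finset.sum_eq_single (s ∘ σ.symm)]
    · have h1 : a ((stdFrame ∘ s) ∘ σ.symm) = Equiv.Perm.sign σ.symm • a (stdFrame ∘ s) :=
        a.toAlternatingMap.map_perm _ _
      rw [if_pos (by ext; simp), ← Function.comp_assoc, h1, Equiv.Perm.sign_symm,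
        Units.smul_def, zsmul_eq_mul, mul_one, mul_right_comm, ← Int.cast_mul, ← Units.val_mul,
        Int.units_mul_self]
      simp
    · intro r _ hr
      rw [if_neg, mul_zero, mul_zero]
      rintro rfl
      exact hr (by ext; simp)
    · simp
  rw [symb_apply, map_smul, map_sum]
  simp_rw [map_smul, coeffAt_covecs, smul_eq_mul]
  simp_rw [Finset.mul_sum (_ : Finset (Equiv.Perm (Fin k)))]
  rw [Finset.sum_comm]
  simp_rw [key]
  rw [Finset.sum_const, Finset.card_univ, Fintype.card_perm, Fintype.card_fin, nsmul_eq_mul,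
    inv_mul_cancel_left₀ h0]

theorem symb_injective (k : ℕ) : Function.Injective (symb : (C3 [⋀^Fin k]→L[ℝ] ℂ) → ExtAlg) :=
  fun a b h => ext_stdFrame fun s => by rw [← coeffAt_symb, ← coeffAt_symb, h]

theorem covecs_insertNth {k : ℕ} (i : Fin (k + 1)) (j : Fin 6) (s : Fin k → Fin 6) :
    covecs (i.insertNth j s : Fin (k + 1) → Fin 6) =
      (-1 : ℂ) ^ i.val • (covec j * covecs s) := by
  rw [← covecs_cons, ← Fin.cons_comp_cycleRange, covecs_comp_perm, Fin.sign_cycleRange,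
    Units.smul_def, ← Int.cast_smul_eq_zsmul ℂ]
  simp

/-- In the exterior algebra alternation becomes left multiplication by covectors. Each of the `k +
1` slots contributes equally, which turns `1/(k+1)!` into `1/k!`. -/
theorem symb_alternatizeUncurryFin {k : ℕ} (L : C3 →L[ℝ] C3 [⋀^Fin k]→L[ℝ] ℂ) :
    symb (.alternatizeUncurryFin L) = ∑ j, covec j * symb (L (stdFrame j)) := by
  have h0 : ((k + 1 : ℕ) : ℂ) ≠ 0 := Nat.cast_ne_zero.2 (Nat.succ_ne_zero _)
  have key : ∀ i : Fin (k + 1), ∑ r : Fin (k + 1) → Fin 6,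
      ((-1) ^ i.val • L ((stdFrame ∘ r) i) (i.removeNth (stdFrame ∘ r))) • covecs r =
      ∑ j, ∑ s : Fin k → Fin 6, L (stdFrame j) (stdFrame ∘ s) • (covec j * covecs s) := by
    intro i
    rw [← Fintype.sum_prod_type']
    symm
    refine Fintype.sum_equiv (Fin.insertNthEquiv (fun _ => Fin 6) i) _ _ fun r => ?_
    have h2 : i.removeNth (stdFrame ∘ (i.insertNth r.1 r.2 : Fin (k + 1) → Fin 6)) =
        stdFrame ∘ r.2 := by
      ext; simp [Fin.removeNth]
    have h3 : (Fin.insertNthEquiv (fun _ => Fin 6) i) r = i.insertNth r.1 r.2 := rfl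
    rw [h3, h2, covecs_insertNth, smul_smul, Function.comp_apply, Fin.insertNth_apply_same,
      ← Int.cast_smul_eq_zsmul ℂ, smul_eq_mul, mul_right_comm]
    push_cast
    rw [← mul_pow]
    simp
  simp_rw [symb_apply, ContinuousAlternatingMap.alternatizeUncurryFin_apply, Finset.sum_smul]
  rw [Finset.sum_comm]
  simp_rw [key, Finset.sum_const, Finset.card_univ, Fintype.card_fin, ← Nat.cast_smul_eq_nsmul ℂ,
    smul_smul, mul_smul_comm, Finset.mul_sum, mul_smul_comm, ← Finset.smul_sum]
  congr 1
  rw [Nat.factorial_succ]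
  push_cast at h0 ⊢
  field_simp

theorem compContinuousLinearMap_wedgeAt {k l : ℕ} (a : C3 [⋀^Fin k]→L[ℝ] ℂ)
    (b : C3 [⋀^Fin l]→L[ℝ] ℂ) (f : C3 →L[ℝ] C3) :
    (wedgeAt a b).compContinuousLinearMap f =
      wedgeAt (a.compContinuousLinearMap f) (b.compContinuousLinearMap f) := by
  ext v
  simp [wedgeAt_apply, Function.comp_def]

instance (k : ℕ) : FiniteDimensional ℝ (C3 [⋀^Fin k]→L[ℝ] ℂ) :=
  Module.Finite.of_injective
    ({ toFun := fun a s => a (stdFrame ∘ s)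
       map_add' := fun _ _ => rfl
       map_smul' := fun _ _ => rfl } : (C3 [⋀^Fin k]→L[ℝ] ℂ) →ₗ[ℝ] (Fin k → Fin 6) → ℂ)
    fun _ _ h => ext_stdFrame (congrFun h)

theorem symb_real_smul {k : ℕ} (c : ℝ) (a : C3 [⋀^Fin k]→L[ℝ] ℂ) :
    symb (c • a) = (c : ℂ) • symb a := by
  rw [← map_smul]
  congr 1

/-- The wedge product as a continuous bilinear map. -/
def wedgeL (k l : ℕ) : (C3 [⋀^Fin k]→L[ℝ] ℂ) →L[ℝ] (C3 [⋀^Fin l]→L[ℝ] ℂ) →L[ℝ]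
    C3 [⋀^Fin (k + l)]→L[ℝ] ℂ :=
  LinearMap.toContinuousBilinearMap
    (LinearMap.mk₂ ℝ wedgeAt
      (fun a a' b => symb_injective _ (by simp [symb_wedgeAt, add_mul]))
      (fun c a b => symb_injective _ (by
        rw [symb_wedgeAt, symb_real_smul, symb_real_smul, symb_wedgeAt, smul_mul_assoc]))
      (fun a b b' => symb_injective _ (by simp [symb_wedgeAt, mul_add]))
      (fun c a b => symb_injective _ (by
        rw [symb_wedgeAt, symb_real_smul, symb_real_smul, symb_wedgeAt, mul_smul_comm])))

/-- A top-degree form is multiplied by the determinant under pullback. -/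
theorem compContinuousLinearMap_stdFrame (a : C3 [⋀^Fin 6]→L[ℝ] ℂ) (f : C3 →L[ℝ] C3) :
    a.compContinuousLinearMap f stdFrame = f.det • a stdFrame := by
  -- The description of top forms by the determinant is for scalar-valued forms over `ℝ`, so it is
  -- applied to the real and imaginary parts.
  have h : ∀ ℓ : ℂ →ₗ[ℝ] ℝ, ℓ (a (f ∘ stdFrame)) = f.det * ℓ (a stdFrame) := by
    intro ℓ
    have h1 := AlternatingMap.eq_smul_basis_det frameBasis
      (ℓ.compAlternatingMap a.toAlternatingMap)
    have h2 := congrArg (fun g => g (f ∘ stdFrame)) h1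
    have h3 : frameBasis.det (f ∘ stdFrame) = f.det := by
      have := frameBasis.det_comp (f : C3 →ₗ[ℝ] C3) frameBasis
      rw [frameBasis.det_self, mul_one, coe_frameBasis] at this
      exact this
    simp only [AlternatingMap.smul_apply, h3, coe_frameBasis, smul_eq_mul] at h2
    rw [mul_comm]
    exact h2
  apply Complex.ext
  · simpa using h Complex.reLm
  · simpa using h Complex.imLm

/-- The symbol of a form of even degree is central. -/
theorem symb_mem_center {k : ℕ} (hk : Even k) (a : C3 [⋀^Fin k]→L[ℝ] ℂ) :
    symb a ∈ Subalgebra.center ℂ ExtAlg := by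
  refine Subalgebra.smul_mem _ (Subalgebra.sum_mem _ fun r _ => Subalgebra.smul_mem _ ?_ _) _
  refine Subalgebra.mem_center_iff.2 fun x => ?_
  induction x using ExteriorAlgebra.induction with
  | algebraMap c => exact Algebra.commutes _ _
  | ι v =>
    have hv : ExteriorAlgebra.ι ℂ v = ∑ j, v j • covec j := by
      simp_rw [covec, ← map_smul, ← map_sum]
      congr 1
      exact pi_eq_sum_univ' v
    rw [hv, Finset.sum_mul, Finset.mul_sum]
    refine Finset.sum_congr rfl fun j _ => ?_
    rw [smul_mul_assoc, mul_smul_comm, covec_mul_covecs, hk.neg_one_pow, one_smul]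
  | mul x y hx hy => rw [mul_assoc, hy, ← mul_assoc, hx, mul_assoc]
  | add x y hx hy => rw [add_mul, mul_add, hx, hy]

end

noncomputable section

/-! ### The operators `∂` and `∂̄` on `ℂ³`, treated simultaneously -/

/-- The linear map `L ↦ (v ↦ ½ (L v + c L (√-1 v)))`; it gives `∂` for `c = -√-1` and `∂̄` for
`c = √-1`. -/
def twist (c : ℂ) (k : ℕ) : (C3 →L[ℝ] C3 [⋀^Fin k]→L[ℝ] ℂ) →L[ℝ] C3 →L[ℝ] C3 [⋀^Fin k]→L[ℝ] ℂ :=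
  LinearMap.toContinuousLinearMap
    { toFun := fun L : C3 →L[ℝ] C3 [⋀^Fin k]→L[ℝ] ℂ => (1 / 2 : ℂ) • (L + c • L.comp mulI)
      map_add' := fun L M => by
        ext v w; simp; ring
      map_smul' := fun r L => by
        ext v w; simp; ring }

theorem twist_apply (c : ℂ) {k : ℕ} (L : C3 →L[ℝ] C3 [⋀^Fin k]→L[ℝ] ℂ) :
    twist c k L = (1 / 2 : ℂ) • (L + c • L.comp mulI) := rfl

/-- The operator `½ (d + c d_J)` on forms on `ℂ³`. -/
def dModel (c : ℂ) {k : ℕ} (a : C3 → C3 [⋀^Fin k]→L[ℝ] ℂ) (z : C3) : C3 [⋀^Fin (k + 1)]→L[ℝ] ℂ :=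
  .alternatizeUncurryFin (twist c k (fderiv ℝ a z))

theorem delModel_eq {k : ℕ} (a : C3 → C3 [⋀^Fin k]→L[ℝ] ℂ) : delModel a = dModel (-Complex.I) a := by
  funext z
  refine congrArg _ (congrArg ((1 / 2 : ℂ) • ·) ?_)
  ext v w
  simp [sub_eq_add_neg]

theorem delbarModel_eq {k : ℕ} (a : C3 → C3 [⋀^Fin k]→L[ℝ] ℂ) :
    delbarModel a = dModel Complex.I a := rfl

theorem symb_dModel (c : ℂ) {k : ℕ} (a : C3 → C3 [⋀^Fin k]→L[ℝ] ℂ) (z : C3) :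
    symb (dModel c a z) = ∑ j, covec j * ((1 / 2 : ℂ) • (symb (fderiv ℝ a z (stdFrame j)) +
      c • symb (fderiv ℝ a z (mulI (stdFrame j))))) := by
  rw [dModel, symb_alternatizeUncurryFin]
  simp [twist_apply]

theorem dModel_congr (c : ℂ) {k : ℕ} {a b : C3 → C3 [⋀^Fin k]→L[ℝ] ℂ} {z : C3}
    (h : a =ᶠ[nhds z] b) : dModel c a z = dModel c b z := by
  rw [dModel, dModel, h.fderiv_eq]

/-- The graded Leibniz rule. The sign comes from moving the covector of the derivative past the `k`
covectors of `a`. -/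
theorem symb_dModel_wedgeAt (c : ℂ) {k l : ℕ} {a : C3 → C3 [⋀^Fin k]→L[ℝ] ℂ}
    {b : C3 → C3 [⋀^Fin l]→L[ℝ] ℂ} {z : C3} (ha : DifferentiableAt ℝ a z)
    (hb : DifferentiableAt ℝ b z) :
    symb (dModel c (fun w => wedgeAt (a w) (b w)) z) =
      symb (dModel c a z) * symb (b z) + (-1 : ℂ) ^ k • (symb (a z) * symb (dModel c b z)) := by
  have hd : ∀ v, fderiv ℝ (fun w => wedgeAt (a w) (b w)) z v =
      wedgeAt (a z) (fderiv ℝ b z v) + wedgeAt (fderiv ℝ a z v) (b z) := fun v => by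
    have := (wedgeL k l).hasFDerivAt_of_bilinear ha.hasFDerivAt hb.hasFDerivAt
    rw [HasFDerivAt.fderiv (f := fun w => wedgeAt (a w) (b w)) this]
    rfl
  have hc : ∀ (j : Fin 6) (u : ExtAlg), covec j * (symb (a z) * u) =
      (-1 : ℂ) ^ k • (symb (a z) * (covec j * u)) := by
    intro j u
    have : covec j * symb (a z) = (-1 : ℂ) ^ k • (symb (a z) * covec j) := by
      simp_rw [symb_apply, mul_smul_comm, smul_mul_assoc, Finset.mul_sum, Finset.sum_mul,
        mul_smul_comm, smul_mul_assoc, covec_mul_covecs]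
      rw [smul_comm]
      congr 1
      rw [Finset.smul_sum]
      exact Finset.sum_congr rfl fun r _ => smul_comm _ _ _
    rw [← mul_assoc, this, smul_mul_assoc, mul_assoc]
  simp_rw [symb_dModel, hd, map_add, symb_wedgeAt, Finset.sum_mul, Finset.mul_sum, Finset.smul_sum]
  rw [← Finset.sum_add_distrib]
  refine Finset.sum_congr rfl fun j _ => ?_
  simp only [mul_add, smul_add, mul_smul_comm, smul_mul_assoc, add_mul, hc, mul_assoc]
  module

theorem hasFDerivAt_clm_comp {E V W : Type*} [NormedAddCommGroup E] [NormedSpace ℝ E]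
    [NormedAddCommGroup V] [NormedSpace ℝ V] [NormedAddCommGroup W] [NormedSpace ℝ W]
    (T : V →L[ℝ] W) {f : E → V} {f' : E →L[ℝ] V} {z : E} (h : HasFDerivAt f f' z) :
    HasFDerivAt (fun w => T (f w)) (T ∘L f') z :=
  T.hasFDerivAt.comp z h

/-- With `X_j^c = ½(D_{e_j} + c D_{Je_j})` the operator is `∑ e^j X_j^c`. Second derivatives commute
and covectors anticommute, so the term indexed by `(i, j)` in one composite cancels the term indexed
by `(j, i)` in the other. Taking `c = c'` gives `∂∂ = 0` and `∂̄∂̄ = 0`; taking `c ≠ c'` gives `∂∂̄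
= -∂̄∂`. -/
theorem dModel_anticomm (c c' : ℂ) {k : ℕ} {a : C3 → C3 [⋀^Fin k]→L[ℝ] ℂ} {z : C3}
    (ha : ContDiffAt ℝ 2 a z) :
    dModel c (dModel c' a) z + dModel c' (dModel c a) z = 0 := by
  have hs : ∀ v w, fderiv ℝ (fderiv ℝ a) z v w = fderiv ℝ (fderiv ℝ a) z w v :=
    ha.isSymmSndFDerivAt (by simp)
  have hdiff : DifferentiableAt ℝ (fderiv ℝ a) z :=
    (ha.fderiv_right (m := 1) le_rfl).differentiableAt one_ne_zero
  have hd : ∀ (c : ℂ) v, symb (fderiv ℝ (dModel c a) z v) = ∑ j, covec j * ((1 / 2 : ℂ) •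
      (symb (fderiv ℝ (fderiv ℝ a) z v (stdFrame j)) +
        c • symb (fderiv ℝ (fderiv ℝ a) z v (mulI (stdFrame j))))) := fun c v => by
    let T := ContinuousAlternatingMap.alternatizeUncurryFinCLM ℝ C3 ℂ ∘L twist c k
    have h1 : HasFDerivAt (dModel c a) (T ∘L fderiv ℝ (fderiv ℝ a) z) z :=
      hasFDerivAt_clm_comp (V := C3 →L[ℝ] C3 [⋀^Fin k]→L[ℝ] ℂ) T hdiff.hasFDerivAt
    rw [h1.fderiv]
    change symb (ContinuousAlternatingMap.alternatizeUncurryFin (twist c k _)) = _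
    rw [symb_alternatizeUncurryFin]
    simp [twist_apply]
  apply symb_injective
  rw [map_add, map_zero, symb_dModel c, symb_dModel c']
  simp_rw [hd, Finset.smul_sum, ← Finset.sum_add_distrib, Finset.smul_sum, Finset.mul_sum]
  rw [Finset.sum_add_distrib]
  nth_rw 1 [Finset.sum_comm]
  rw [← Finset.sum_add_distrib]
  refine Finset.sum_eq_zero fun i _ => ?_
  rw [← Finset.sum_add_distrib]
  refine Finset.sum_eq_zero fun j _ => ?_
  rw [hs (mulI (stdFrame j)) (mulI (stdFrame i)), hs (mulI (stdFrame j)) (stdFrame i),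
    hs (stdFrame j) (mulI (stdFrame i)), hs (stdFrame j) (stdFrame i)]
  simp only [mul_add, smul_add, mul_smul_comm, ← mul_assoc, covec_mul_covec j i, neg_mul]
  module

theorem fderiv_mulI {g : C3 → C3} {z : C3} (hg : DifferentiableAt ℂ g z) (v : C3) :
    fderiv ℝ g z (mulI v) = mulI (fderiv ℝ g z v) := by
  rw [hg.fderiv_restrictScalars ℝ]
  exact (fderiv ℂ g z).map_smul Complex.I v

/-- `dModel c` commutes with pullback under holomorphic maps. -/
theorem dModel_pullback (c : ℂ) {k : ℕ} {a : C3 → C3 [⋀^Fin k]→L[ℝ] ℂ} {g : C3 → C3} {z : C3}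
    (ha : DifferentiableAt ℝ a (g z)) (hg : ContDiffAt ℂ 2 g z) :
    dModel c (fun w => (a (g w)).compContinuousLinearMap (fderiv ℝ g w)) z =
      (dModel c a (g z)).compContinuousLinearMap (fderiv ℝ g z) := by
  have hgr : ContDiffAt ℝ 2 g z := hg.restrict_scalars ℝ
  have hdg : DifferentiableAt ℝ g z := hgr.differentiableAt two_ne_zero
  have hd2g : DifferentiableAt ℝ (fderiv ℝ g) z :=
    (hgr.fderiv_right (m := 1) le_rfl).differentiableAt one_ne_zero
  have hs : ∀ v w, fderiv ℝ (fderiv ℝ g) z v w = fderiv ℝ (fderiv ℝ g) z w v :=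
    hgr.isSymmSndFDerivAt (by simp)
  -- Differentiating the Cauchy–Riemann identity `Dg ∘ J = J ∘ Dg`, valid near `z`, gives the same
  -- identity for the second derivative.
  have hJ : ∀ v w, fderiv ℝ (fderiv ℝ g) z v (mulI w) = mulI (fderiv ℝ (fderiv ℝ g) z v w) := by
    intro v w
    have he : (fun x => fderiv ℝ g x (mulI w)) =ᶠ[nhds z] fun x => mulI (fderiv ℝ g x w) := by
      filter_upwards [hg.eventually (by simp)] with x hx
      exact fderiv_mulI (hx.differentiableAt two_ne_zero) w
    have h1 : HasFDerivAt (fun x => fderiv ℝ g x (mulI w))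
        ((fderiv ℝ (fderiv ℝ g) z).flip (mulI w)) z := by
      simpa using hd2g.hasFDerivAt.clm_apply (hasFDerivAt_const (mulI w) z)
    have h2 : HasFDerivAt (fun x => mulI (fderiv ℝ g x w))
        (mulI ∘L (fderiv ℝ (fderiv ℝ g) z).flip w) z := by
      refine mulI.hasFDerivAt.comp z ?_
      simpa using hd2g.hasFDerivAt.clm_apply (hasFDerivAt_const w z)
    have h3 := (h1.congr_of_eventuallyEq he.symm).unique h2
    exact congrArg (fun f => f v) h3
  have hf := fderiv_continuousAlternatingMapCompContinuousLinearMap (ha.comp z hdg) hd2g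
  have hc : fderiv ℝ (a ∘ g) z = fderiv ℝ a (g z) ∘L fderiv ℝ g z :=
    fderiv_comp z ha hdg
  rw [dModel, twist_apply]
  change fderiv ℝ (fun w => (a (g w)).compContinuousLinearMap (fderiv ℝ g w)) z = _ at hf
  rw [hf, hc]
  set B := (a (g z)).fderivCompContinuousLinearMap (fderiv ℝ g z)
  -- The product rule leaves terms containing `D²g`. They alternate to zero because `D²g` is
  -- symmetric, and so is `(v, w) ↦ D²g(Jv, w)`, which equals `J D²g(v, w)` for holomorphic `g`.
  have z1 : ContinuousAlternatingMap.alternatizeUncurryFin (B ∘L fderiv ℝ (fderiv ℝ g) z) = 0 :=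
    ContinuousAlternatingMap.alternatizeUncurryFin_fderivCompContinuousLinearMap_eq_zero _ _ hs
  have z2 : ContinuousAlternatingMap.alternatizeUncurryFin
      (B ∘L (fderiv ℝ (fderiv ℝ g) z ∘L mulI)) = 0 :=
    ContinuousAlternatingMap.alternatizeUncurryFin_fderivCompContinuousLinearMap_eq_zero _ _
      fun v w => by
        simp only [ContinuousLinearMap.comp_apply]
        rw [hs (mulI v), hJ, hs (mulI w), hJ, hs]
  have z1' := fun v => congrArg (fun f => f v) z1
  have z2' := fun v => congrArg (fun f => f v) z2
  ext v
  have hJv : ∀ i, fderiv ℝ g z (mulI (v i)) = mulI (fderiv ℝ g z (v i)) := fun i =>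
    fderiv_mulI (hg.differentiableAt two_ne_zero) _
  specialize z1' v
  specialize z2' v
  simp only [ContinuousAlternatingMap.alternatizeUncurryFin_apply,
    ContinuousLinearMap.comp_apply] at z1' z2'
  simp only [dModel, twist_apply, ContinuousAlternatingMap.alternatizeUncurryFin_apply,
    ContinuousAlternatingMap.compContinuousLinearMap_apply, _root_.add_apply,
    _root_.smul_apply, ContinuousLinearMap.comp_apply,
    ContinuousAlternatingMap.add_apply, ContinuousAlternatingMap.smul_apply,
    ContinuousAlternatingMap.compContinuousLinearMapCLM_apply, hJv, Function.comp_apply]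
  have hrem : ∀ i : Fin (k + 1), i.removeNth (fderiv ℝ g z ∘ v) = fderiv ℝ g z ∘ i.removeNth v :=
    fun i => rfl
  change _ = (0 : ℂ) at z1' z2'
  rw [← sub_eq_zero, ← Finset.sum_sub_distrib]
  trans (1 / 2 : ℂ) • (∑ i : Fin (k + 1), (-1 : ℤ) ^ (i : ℕ) •
      B (fderiv ℝ (fderiv ℝ g) z (v i)) (i.removeNth v)) + (c / 2) •
      ∑ i : Fin (k + 1), (-1 : ℤ) ^ (i : ℕ) •
        B (fderiv ℝ (fderiv ℝ g) z (mulI (v i))) (i.removeNth v)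
  · rw [Finset.smul_sum, Finset.smul_sum, ← Finset.sum_add_distrib]
    refine Finset.sum_congr rfl fun i _ => ?_
    simp only [hrem, zsmul_eq_mul, smul_eq_mul]
    ring
  · rw [z1', z2', smul_zero, smul_zero, add_zero]

theorem dModel_add (c : ℂ) {k : ℕ} {a b : C3 → C3 [⋀^Fin k]→L[ℝ] ℂ} {z : C3}
    (ha : DifferentiableAt ℝ a z) (hb : DifferentiableAt ℝ b z) :
    dModel c (a + b) z = dModel c a z + dModel c b z := by
  rw [dModel, fderiv_add ha hb, map_add, ContinuousAlternatingMap.alternatizeUncurryFin_add]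
  rfl

theorem dModel_const_smul (c b : ℂ) {k : ℕ} (a : C3 → C3 [⋀^Fin k]→L[ℝ] ℂ) (z : C3) :
    dModel c (b • a) z = b • dModel c a z := by
  apply symb_injective
  have h : ∀ v, fderiv ℝ (b • a) z v = b • fderiv ℝ a z v := fun v =>
    congrArg (fun f : C3 →L[ℝ] C3 [⋀^Fin k]→L[ℝ] ℂ => f v)
      (congrFun (fderiv_const_smul_field (F := C3 [⋀^Fin k]→L[ℝ] ℂ) b) z)
  rw [map_smul, symb_dModel, symb_dModel, Finset.smul_sum]
  refine Finset.sum_congr rfl fun j _ => ?_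
  rw [h, h, map_smul, map_smul, ← mul_smul_comm]
  congr 1
  module

/-- The integral of an exact form with compact support vanishes. -/
theorem integral_dModel_eq_zero (c : ℂ) {a : C3 → C3 [⋀^Fin 5]→L[ℝ] ℂ}
    (ha : ContDiff ℝ 1 a) (hs : HasCompactSupport a) :
    ∫ z, dModel c a z stdFrame = 0 := by
  have hline : ∀ v : C3, ∀ w : Fin 5 → C3,
      MeasureTheory.Integrable (fun z => fderiv ℝ a z v w) ∧ ∫ z, fderiv ℝ a z v w = 0 := by
    intro v w
    let ev : (C3 [⋀^Fin 5]→L[ℝ] ℂ) →L[ℝ] ℂ := ContinuousAlternatingMap.apply ℝ C3 ℂ w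
    have hd : ∀ z, HasFDerivAt (fun z => a z w) (ev ∘L fderiv ℝ a z) z := fun z =>
      ev.hasFDerivAt.comp z (ha.differentiable one_ne_zero z).hasFDerivAt
    have hcont : Continuous fun z => fderiv ℝ a z v w :=
      ev.continuous.comp ((ha.continuous_fderiv one_ne_zero).clm_apply continuous_const)
    have hcs : HasCompactSupport fun z => fderiv ℝ a z v w :=
      (hs.fderiv (𝕜 := ℝ)).comp_left (g := fun L : C3 →L[ℝ] C3 [⋀^Fin 5]→L[ℝ] ℂ => L v w) rfl
    have hi := hcont.integrable_of_hasCompactSupport (μ := MeasureTheory.volume) hcs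
    have hi0 : MeasureTheory.Integrable (fun z => a z w) :=
      (ev.continuous.comp ha.continuous).integrable_of_hasCompactSupport
        (hs.comp_left (g := fun L : C3 [⋀^Fin 5]→L[ℝ] ℂ => L w) rfl)
    refine ⟨hi, ?_⟩
    -- Integration by parts against the constant function `1`: the integral of a directional
    -- derivative of an integrable coefficient vanishes.
    have := integral_bilinear_hasLineDerivAt_right_eq_neg_left_of_integrable
      (μ := MeasureTheory.volume) (f := fun _ : C3 => (1 : ℂ)) (f' := fun _ => 0)
      (g := fun z => a z w) (g' := fun z => fderiv ℝ a z v w) (v := v)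
      (B := ContinuousLinearMap.mul ℝ ℂ) (by simp) (by simpa using hi) (by simpa using hi0)
      (fun z _ => by simpa using (hasFDerivAt_const (1 : ℂ) z).hasLineDerivAt v)
      (fun z _ => (hd z).hasLineDerivAt v)
    simpa using this
  have hz : ∀ z, dModel c a z stdFrame = ∑ i : Fin 6, ((-1 : ℂ) ^ (i : ℕ) * (1 / 2)) *
      (fderiv ℝ a z (stdFrame i) (i.removeNth stdFrame) +
        c * fderiv ℝ a z (mulI (stdFrame i)) (i.removeNth stdFrame)) := fun z => by
    simp only [dModel, ContinuousAlternatingMap.alternatizeUncurryFin_apply, twist_apply,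
      _root_.add_apply, _root_.smul_apply, ContinuousLinearMap.comp_apply,
      ContinuousAlternatingMap.add_apply, ContinuousAlternatingMap.smul_apply, zsmul_eq_mul,
      smul_eq_mul, mul_assoc]
    push_cast
    rfl
  have hterm : ∀ (i : Fin 6), MeasureTheory.Integrable fun z =>
      fderiv ℝ a z (stdFrame i) (i.removeNth stdFrame) +
        c * fderiv ℝ a z (mulI (stdFrame i)) (i.removeNth stdFrame) := fun i =>
    (hline _ _).1.add ((hline _ _).1.const_mul c)
  simp_rw [hz]
  rw [MeasureTheory.integral_finsetSum _ fun i _ => (hterm i).const_mul _]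
  refine Finset.sum_eq_zero fun i _ => ?_
  rw [MeasureTheory.integral_const_mul,
    MeasureTheory.integral_add (hline _ _).1 ((hline _ _).1.const_mul c),
    MeasureTheory.integral_const_mul, (hline _ _).2, (hline _ _).2]
  simp

end

noncomputable section

/-! ### Derivatives of functions on `[0,1] × U` -/

section Parametric

variable {V : Type*} [NormedAddCommGroup V] [NormedSpace ℝ V] {f : ℝ × C3 → V} {U : Set C3}

theorem uniqueDiffOn_strip (hU : IsOpen U) : UniqueDiffOn ℝ (Set.Icc (0 : ℝ) 1 ×ˢ U) :=
  (uniqueDiffOn_Icc zero_lt_one).prod hU.uniqueDiffOn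

theorem hasFDerivAt_slice (hU : IsOpen U) {p : ℝ × C3} (hp : p ∈ Set.Icc (0 : ℝ) 1 ×ˢ U)
    (hf : DifferentiableWithinAt ℝ f (Set.Icc (0 : ℝ) 1 ×ˢ U) p) :
    HasFDerivAt (fun z => f (p.1, z))
      (fderivWithin ℝ f (Set.Icc (0 : ℝ) 1 ×ˢ U) p ∘L ContinuousLinearMap.inr ℝ ℝ C3) p.2 := by
  have h := hf.hasFDerivWithinAt.comp (f := fun z => (p.1, z)) (s := U) p.2
    (hasFDerivAt_prodMk_right p.1 p.2).hasFDerivWithinAt fun z hz => ⟨hp.1, hz⟩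
  exact h.hasFDerivAt (hU.mem_nhds hp.2)

theorem hasDerivWithinAt_slice {p : ℝ × C3} (hp : p ∈ Set.Icc (0 : ℝ) 1 ×ˢ U)
    (hf : DifferentiableWithinAt ℝ f (Set.Icc (0 : ℝ) 1 ×ˢ U) p) :
    HasDerivWithinAt (fun s => f (s, p.2))
      (fderivWithin ℝ f (Set.Icc (0 : ℝ) 1 ×ˢ U) p (1, 0)) (Set.Icc 0 1) p.1 := by
  have h := hf.hasFDerivWithinAt.comp (f := fun s => (s, p.2)) (s := Set.Icc 0 1) p.1
    (hasFDerivAt_prodMk_left p.1 p.2).hasFDerivWithinAt fun s hs => ⟨hs, hp.2⟩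
  simpa [Function.comp_def] using h.hasDerivWithinAt

theorem contDiffOn_fderiv_slice (hU : IsOpen U) (hf : ContDiffOn ℝ ∞ f (Set.Icc (0 : ℝ) 1 ×ˢ U)) :
    ContDiffOn ℝ ∞ (fun p : ℝ × C3 => fderiv ℝ (fun z => f (p.1, z)) p.2)
      (Set.Icc (0 : ℝ) 1 ×ˢ U) := by
  have h := (hf.fderivWithin (uniqueDiffOn_strip hU) (m := ∞) (by simp)).clm_comp
    (contDiffOn_const (c := ContinuousLinearMap.inr ℝ ℝ C3))
  exact h.congr fun p hp =>
    (hasFDerivAt_slice hU hp ((hf.differentiableOn (by simp)) p hp)).fderiv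

theorem contDiffOn_derivWithin_slice (hU : IsOpen U)
    (hf : ContDiffOn ℝ ∞ f (Set.Icc (0 : ℝ) 1 ×ˢ U)) :
    ContDiffOn ℝ ∞ (fun p : ℝ × C3 => derivWithin (fun s => f (s, p.2)) (Set.Icc 0 1) p.1)
      (Set.Icc (0 : ℝ) 1 ×ˢ U) := by
  have h := (hf.fderivWithin (uniqueDiffOn_strip hU) (m := ∞) (by simp)).clm_apply
    (contDiffOn_const (c := ((1 : ℝ), (0 : C3))))
  exact h.congr fun p hp =>
    (hasDerivWithinAt_slice hp ((hf.differentiableOn (by simp)) p hp)).derivWithin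
      (uniqueDiffOn_Icc zero_lt_one _ hp.1)

/-- The derivatives in the parameter and in the space variable commute. -/
theorem hasDerivWithinAt_fderiv_slice (hU : IsOpen U)
    (hf : ContDiffOn ℝ ∞ f (Set.Icc (0 : ℝ) 1 ×ˢ U)) {t : ℝ} (ht : t ∈ Set.Icc (0 : ℝ) 1) {z : C3}
    (hz : z ∈ U) :
    HasDerivWithinAt (fun s => fderiv ℝ (fun w => f (s, w)) z)
      (fderiv ℝ (fun w => derivWithin (fun s => f (s, w)) (Set.Icc 0 1) t) z) (Set.Icc 0 1) t := by
  set S := Set.Icc (0 : ℝ) 1 ×ˢ U with hS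
  have hp : (t, z) ∈ S := ⟨ht, hz⟩
  have hu : UniqueDiffOn ℝ S := uniqueDiffOn_strip hU
  have hd := hf.differentiableOn (by simp)
  have h2 : DifferentiableWithinAt ℝ (fderivWithin ℝ f S) S (t, z) :=
    (hf.fderivWithin hu (m := ∞) (by simp)).differentiableOn (by simp) _ hp
  -- At `t = 0` and `t = 1` the point is on the boundary of the strip. Symmetry of the second
  -- derivative within the strip still holds there, because the point is a limit of interior points.
  have hcl : (t, z) ∈ closure (interior S) := by
    rw [hS, interior_prod_eq, closure_prod_eq, interior_Icc, closure_Ioo zero_ne_one,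
      hU.interior_eq]
    exact ⟨ht, subset_closure hz⟩
  have hsymm := (hf (t, z) hp).isSymmSndFDerivWithinAt
    (by rw [minSmoothness_of_isRCLikeNormedField]; exact WithTop.coe_le_coe.2 le_top) hu hcl hp
  have h3 := hasDerivWithinAt_slice hp
    (contDiffOn_fderiv_slice hU hf |>.differentiableOn (by simp) _ hp)
  have h4 : HasFDerivAt (fun w => derivWithin (fun s => f (s, w)) (Set.Icc 0 1) t) _ z :=
    hasFDerivAt_slice hU hp (contDiffOn_derivWithin_slice hU hf |>.differentiableOn (by simp) _ hp)
  convert! h3 using 1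
  rw [h4.fderiv]
  have e1 : fderivWithin ℝ (fun p : ℝ × C3 => fderiv ℝ (fun z => f (p.1, z)) p.2) S (t, z) =
      fderivWithin ℝ (fun p => fderivWithin ℝ f S p ∘L ContinuousLinearMap.inr ℝ ℝ C3) S (t, z) :=
    fderivWithin_congr (fun p hp => (hasFDerivAt_slice hU hp (hd p hp)).fderiv)
      (hasFDerivAt_slice hU hp (hd _ hp)).fderiv
  have e2 : fderivWithin ℝ (fun p : ℝ × C3 => derivWithin (fun s => f (s, p.2)) (Set.Icc 0 1) p.1)
      S (t, z) = fderivWithin ℝ (fun p => fderivWithin ℝ f S p (1, 0)) S (t, z) :=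
    fderivWithin_congr (fun p hp => (hasDerivWithinAt_slice hp (hd p hp)).derivWithin
      (uniqueDiffOn_Icc zero_lt_one _ hp.1)) ((hasDerivWithinAt_slice hp (hd _ hp)).derivWithin
      (uniqueDiffOn_Icc zero_lt_one _ hp.1))
  rw [e1, e2]
  have e3 := (h2.hasFDerivWithinAt.clm_comp (hasFDerivWithinAt_const
    (ContinuousLinearMap.inr ℝ ℝ C3) (t, z) S)).fderivWithin (hu _ hp)
  have e4 := (h2.hasFDerivWithinAt.clm_apply (hasFDerivWithinAt_const
    ((1 : ℝ), (0 : C3)) (t, z) S)).fderivWithin (hu _ hp)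
  rw [e3, e4]
  ext v
  simpa using hsymm (0, v) (1, 0)

end Parametric

/-! ### Changes of coordinates -/

namespace CForm

variable {X : Type*} [TopologicalSpace X] [ChartedSpace C3 X]

theorem inChart_self {k : ℕ} (α : CForm X k) (x : X) : α.inChart x (chartAt C3 x x) = α x := by
  have hx : (chartAt C3 x).symm (chartAt C3 x x) = x :=
    (chartAt C3 x).left_inv (mem_chart_source C3 x)
  have hd : fderiv ℝ (chartAt C3 x ∘ (chartAt C3 x).symm) (chartAt C3 x x) =
      ContinuousLinearMap.id ℝ C3 := by
    have : (chartAt C3 x ∘ (chartAt C3 x).symm) =ᶠ[nhds (chartAt C3 x x)] id := by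
      filter_upwards [(chartAt C3 x).open_target.mem_nhds (mem_chart_target C3 x)] with z hz
      exact (chartAt C3 x).right_inv hz
    rw [this.fderiv_eq, fderiv_id]
  rw [inChart, hx, hd]
  ext v
  rfl

theorem inChart_ofFun (f : X → ℂ) (c : X) (z : C3) :
    (ofFun f).inChart c z =
      ContinuousAlternatingMap.constOfIsEmpty ℝ C3 (Fin 0) (f ((chartAt C3 c).symm z)) := by
  ext v
  rfl

theorem inChart_wedge {k l : ℕ} (α : CForm X k) (β : CForm X l) (c : X) (z : C3) :
    (α ⋏ β).inChart c z = wedgeAt (α.inChart c z) (β.inChart c z) :=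
  compContinuousLinearMap_wedgeAt _ _ _

theorem inChart_fmul {k : ℕ} (f : X → ℝ) (α : CForm X k) (c : X) (z : C3) :
    (α.fmul f).inChart c z = f ((chartAt C3 c).symm z) • α.inChart c z := by
  ext v
  simp [inChart, fmul]

theorem inChart_add {k : ℕ} (α β : CForm X k) (c : X) (z : C3) :
    (α + β).inChart c z = α.inChart c z + β.inChart c z := rfl

theorem inChart_smul {k : ℕ} (b : ℂ) (α : CForm X k) (c : X) (z : C3) :
    (b • α).inChart c z = b • α.inChart c z := rfl

/-- `∂` for `c = -√-1` and `∂̄` for `c = √-1`. -/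
def dOp (c : ℂ) {k : ℕ} (α : CForm X k) :
    CForm X (k + 1) :=
  fun x => dModel c (α.inChart x) (chartAt C3 x x)

theorem del_eq_dOp {k : ℕ} (α : CForm X k) : α.del = dOp (-Complex.I) α := by
  funext x
  rw [del, delModel_eq, dOp]

theorem delbar_eq_dOp {k : ℕ}
    (α : CForm X k) : α.delbar = dOp Complex.I α := by
  funext x
  rw [delbar, delbarModel_eq, dOp]

theorem IsSmooth.differentiableAt {k : ℕ}
    {α : CForm X k} (hα : α.IsSmooth) (c : X) {z : C3} (hz : z ∈ (chartAt C3 c).target) :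
    DifferentiableAt ℝ (α.inChart c) z :=
  ((hα c).contDiffAt ((chartAt C3 c).open_target.mem_nhds hz)).differentiableAt (by simp)

theorem eventually_mem_overlap (c c' : X) {z : C3} (hz : z ∈ (chartAt C3 c).target)
    (hz' : (chartAt C3 c).symm z ∈ (chartAt C3 c').source) :
    ∀ᶠ w in nhds z, w ∈ (chartAt C3 c).target ∧ (chartAt C3 c).symm w ∈ (chartAt C3 c').source := by
  have := ((chartAt C3 c).symm.trans (chartAt C3 c')).open_source.mem_nhds
    (show z ∈ _ by simpa using ⟨hz, hz'⟩)
  filter_upwards [this] with w hw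
  simpa using hw

variable [IsManifold 𝓘(ℂ, C3) ω X]

theorem contDiffAt_transition (c c' : X) {z : C3} (hz : z ∈ (chartAt C3 c).target)
    (hz' : (chartAt C3 c).symm z ∈ (chartAt C3 c').source) :
    ContDiffAt ℂ ω (chartAt C3 c' ∘ (chartAt C3 c).symm) z := by
  have h := StructureGroupoid.compatible (contDiffGroupoid ω 𝓘(ℂ, C3))
    (chart_mem_atlas C3 c) (chart_mem_atlas C3 c')
  rw [contDiffGroupoid, mem_groupoid_of_pregroupoid] at h
  have h1 : ContDiffOn ℂ ω (chartAt C3 c' ∘ (chartAt C3 c).symm)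
    ((chartAt C3 c).symm.trans (chartAt C3 c')).source := by simpa [contDiffPregroupoid] using h.1
  exact h1.contDiffAt (((chartAt C3 c).symm.trans (chartAt C3 c')).open_source.mem_nhds
    (by simpa using ⟨hz, hz'⟩))

/-- The expressions of a form in two charts are related by pullback. -/
theorem inChart_transition {k : ℕ} (α : CForm X k) (c c' : X) {z : C3}
    (hz : z ∈ (chartAt C3 c).target) (hz' : (chartAt C3 c).symm z ∈ (chartAt C3 c').source) :
    α.inChart c z = (α.inChart c' (chartAt C3 c' ((chartAt C3 c).symm z))).compContinuousLinearMap
      (fderiv ℝ (chartAt C3 c' ∘ (chartAt C3 c).symm) z) := by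
  set y := (chartAt C3 c).symm z with hy
  have hy' : (chartAt C3 c').symm (chartAt C3 c' y) = y := (chartAt C3 c').left_inv hz'
  have hd : fderiv ℝ (chartAt C3 y ∘ (chartAt C3 c).symm) z =
      fderiv ℝ (chartAt C3 y ∘ (chartAt C3 c').symm) (chartAt C3 c' y) ∘L
        fderiv ℝ (chartAt C3 c' ∘ (chartAt C3 c).symm) z := by
    have he : (chartAt C3 y ∘ (chartAt C3 c).symm) =ᶠ[nhds z]
        (chartAt C3 y ∘ (chartAt C3 c').symm) ∘ (chartAt C3 c' ∘ (chartAt C3 c).symm) := by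
      filter_upwards [eventually_mem_overlap c c' hz hz'] with w hw
      simp [(chartAt C3 c').left_inv hw.2]
    rw [he.fderiv_eq]
    refine fderiv_comp z ?_ ?_
    · refine ((contDiffAt_transition c' y ((chartAt C3 c').map_source hz') ?_).restrict_scalars
        ℝ).differentiableAt (by simp)
      rw [hy']
      exact mem_chart_source C3 y
    · exact ((contDiffAt_transition c c' hz hz').restrict_scalars ℝ).differentiableAt (by simp)
  rw [inChart, inChart, hy', ← hy, hd]
  rfl

/-- By definition `dOp` at a point uses the preferred chart of that point, which may jump from point
to point. Naturality under the holomorphic transition maps lets a single chart compute it near any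
point; smoothness of `dOp b α` and the relations between `∂` and `∂̄` depend on this. -/
theorem inChart_dOp {k : ℕ} (b : ℂ) {α : CForm X k} (hα : α.IsSmooth) (c : X) {z : C3}
    (hz : z ∈ (chartAt C3 c).target) :
    (dOp b α).inChart c z = dModel b (α.inChart c) z := by
  set y := (chartAt C3 c).symm z with hy
  have hys : y ∈ (chartAt C3 y).source := mem_chart_source C3 y
  have he : α.inChart c =ᶠ[nhds z] fun w =>
      (α.inChart y ((chartAt C3 y ∘ (chartAt C3 c).symm) w)).compContinuousLinearMap
        (fderiv ℝ (chartAt C3 y ∘ (chartAt C3 c).symm) w) := by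
    filter_upwards [eventually_mem_overlap c y hz hys] with w hw
    exact inChart_transition α c y hw.1 hw.2
  rw [dModel_congr b he, dModel_pullback b (hα.differentiableAt y ((chartAt C3 y).map_source hys))
    ((contDiffAt_transition c y hz hys).of_le le_top)]
  rfl

end CForm

end

noncomputable section

theorem hasDerivWithinAt_clm_comp {V W : Type*} [NormedAddCommGroup V] [NormedSpace ℝ V]
    [NormedAddCommGroup W] [NormedSpace ℝ W] (T : V →L[ℝ] W) {f : ℝ → V} {f' : V} {s : Set ℝ}
    {t : ℝ} (h : HasDerivWithinAt f f' s t) :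
    HasDerivWithinAt (fun r => T (f r)) (T f') s t :=
  T.hasFDerivAt.comp_hasDerivWithinAt t h

namespace CForm

/-! ### Smooth families of forms -/

section Families

variable {X : Type*} [TopologicalSpace X] [ChartedSpace C3 X] {k l : ℕ}

/-- A family of forms parametrised by `[0,1]`, smooth on `[0,1] × X`. -/
def IsSmoothFamily (α : ℝ → CForm X k) : Prop :=
  ∀ c : X, ContDiffOn ℝ ∞ (fun p : ℝ × C3 => (α p.1).inChart c p.2)
    (Set.Icc 0 1 ×ˢ (chartAt C3 c).target)

/-- A family of functions parametrised by `[0,1]`, smooth on `[0,1] × X`. -/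
def IsSmoothFunFamily (f : ℝ → X → ℝ) : Prop :=
  ∀ c : X, ContDiffOn ℝ ∞ (fun p : ℝ × C3 => f p.1 ((chartAt C3 c).symm p.2))
    (Set.Icc 0 1 ×ˢ (chartAt C3 c).target)

theorem IsSmoothFamily.isSmooth {α : ℝ → CForm X k} (h : IsSmoothFamily α) {t : ℝ}
    (ht : t ∈ Set.Icc (0 : ℝ) 1) : (α t).IsSmooth := fun c =>
  (h c).comp (f := fun z : C3 => (t, z)) (contDiffOn_const.prodMk contDiffOn_id)
    fun _ hz => ⟨ht, hz⟩

theorem IsSmooth.family {α : CForm X k} (h : α.IsSmooth) : IsSmoothFamily fun _ => α := fun c =>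
  (h c).comp contDiffOn_snd fun _ hp => hp.2

theorem isSmooth_of_family {α : CForm X k} (h : IsSmoothFamily fun _ => α) : α.IsSmooth :=
  h.isSmooth (t := 0) (by simp)

theorem IsSmoothFamily.add {α β : ℝ → CForm X k} (hα : IsSmoothFamily α) (hβ : IsSmoothFamily β) :
    IsSmoothFamily fun t => α t + β t := fun c => (hα c).add (hβ c)

theorem IsSmoothFamily.smul {α : ℝ → CForm X k} (b : ℂ) (hα : IsSmoothFamily α) :
    IsSmoothFamily fun t => b • α t := fun c => (hα c).const_smul b

theorem IsSmoothFamily.wedge {α : ℝ → CForm X k} {β : ℝ → CForm X l} (hα : IsSmoothFamily α)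
    (hβ : IsSmoothFamily β) : IsSmoothFamily fun t => α t ⋏ β t := fun c =>
  ((wedgeL k l).isBoundedBilinearMap.contDiff.comp_contDiffOn ((hα c).prodMk (hβ c))).congr
    fun _ _ => inChart_wedge _ _ _ _

theorem IsSmoothFunFamily.fmul {f : ℝ → X → ℝ} {α : ℝ → CForm X k} (hf : IsSmoothFunFamily f)
    (hα : IsSmoothFamily α) : IsSmoothFamily fun t => (α t).fmul (f t) := fun c =>
  ((hf c).smul (hα c)).congr fun _ _ => inChart_fmul _ _ _ _

theorem IsSmoothFunFamily.ofFun {f : ℝ → X → ℝ} (hf : IsSmoothFunFamily f) :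
    IsSmoothFamily fun t => ofFun fun x => (f t x : ℂ) := fun c => by
  have h : ContDiffOn ℝ ∞ (fun p : ℝ × C3 => (f p.1 ((chartAt C3 c).symm p.2) : ℂ))
      (Set.Icc 0 1 ×ˢ (chartAt C3 c).target) := Complex.ofRealCLM.contDiff.comp_contDiffOn (hf c)
  have h2 := (ContinuousAlternatingMap.constOfIsEmptyLIE ℝ C3 ℂ (Fin 0)).contDiff.comp_contDiffOn h
  exact h2.congr fun _ _ => inChart_ofFun _ _ _

theorem isSmooth_one : (ofFun fun _ : X => (1 : ℂ)).IsSmooth := fun _ =>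
  (contDiffOn_const (c := ContinuousAlternatingMap.constOfIsEmpty ℝ C3 (Fin 0) (1 : ℂ))).congr
    fun _ _ => inChart_ofFun _ _ _

/-- `α'` is the derivative of the smooth family `α` with respect to the parameter. -/
structure HasTimeDeriv (α α' : ℝ → CForm X k) : Prop where
  smooth : IsSmoothFamily α
  smooth' : IsSmoothFamily α'
  deriv : ∀ t ∈ Set.Icc (0 : ℝ) 1, ∀ x, HasDerivWithinAt (fun s => α s x) (α' t x) (Set.Icc 0 1) t

theorem HasTimeDeriv.add {α α' β β' : ℝ → CForm X k} (hα : HasTimeDeriv α α')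
    (hβ : HasTimeDeriv β β') :
    HasTimeDeriv (fun t => α t + β t) (fun t => α' t + β' t) :=
  ⟨hα.smooth.add hβ.smooth, hα.smooth'.add hβ.smooth',
    fun t ht x => (hα.deriv t ht x).add (hβ.deriv t ht x)⟩

theorem HasTimeDeriv.smul {α α' : ℝ → CForm X k} (b : ℂ) (hα : HasTimeDeriv α α') :
    HasTimeDeriv (fun t => b • α t) (fun t => b • α' t) :=
  ⟨hα.smooth.smul b, hα.smooth'.smul b, fun t ht x => (hα.deriv t ht x).const_smul b⟩

theorem HasTimeDeriv.wedge {α α' : ℝ → CForm X k} {β β' : ℝ → CForm X l} (hα : HasTimeDeriv α α')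
    (hβ : HasTimeDeriv β β') :
    HasTimeDeriv (fun t => α t ⋏ β t) (fun t => α t ⋏ β' t + α' t ⋏ β t) :=
  ⟨hα.smooth.wedge hβ.smooth, (hα.smooth.wedge hβ.smooth').add (hα.smooth'.wedge hβ.smooth),
    fun t ht x => by
      have h := (wedgeL k l).hasFDerivWithinAt_of_bilinear (hα.deriv t ht x).hasFDerivWithinAt
        (hβ.deriv t ht x).hasFDerivWithinAt
      refine h.hasDerivWithinAt.congr_deriv ?_
      change wedgeL k l (α t x) ((1 : ℝ) • β' t x) + wedgeL k l ((1 : ℝ) • α' t x) (β t x) = _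
      rw [one_smul, one_smul]
      rfl⟩

theorem HasTimeDeriv.const {α : CForm X k} (hα : α.IsSmooth) :
    HasTimeDeriv (fun _ => α) (fun _ => 0) :=
  ⟨hα.family, fun _ => contDiffOn_const (c := 0), fun t _ x => hasDerivWithinAt_const t _ (α x)⟩

/-- `f'` is the derivative of the smooth family of functions `f` with respect to the parameter. -/
structure HasTimeDerivFun (f f' : ℝ → X → ℝ) : Prop where
  smooth : IsSmoothFunFamily f
  smooth' : IsSmoothFunFamily f'
  deriv : ∀ t ∈ Set.Icc (0 : ℝ) 1, ∀ x, HasDerivWithinAt (fun s => f s x) (f' t x) (Set.Icc 0 1) t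

theorem HasTimeDerivFun.fmul {f f' : ℝ → X → ℝ} {α α' : ℝ → CForm X k} (hf : HasTimeDerivFun f f')
    (hα : HasTimeDeriv α α') :
    HasTimeDeriv (fun t => (α t).fmul (f t)) (fun t => (α' t).fmul (f t) + (α t).fmul (f' t)) :=
  ⟨hf.smooth.fmul hα.smooth, (hf.smooth.fmul hα.smooth').add (hf.smooth'.fmul hα.smooth),
    fun t ht x => (hf.deriv t ht x).ofReal_comp.smul (hα.deriv t ht x)⟩

theorem HasTimeDerivFun.ofFun {f f' : ℝ → X → ℝ} (hf : HasTimeDerivFun f f') :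
    HasTimeDeriv (fun t => CForm.ofFun fun x => (f t x : ℂ))
      (fun t => CForm.ofFun fun x => (f' t x : ℂ)) :=
  ⟨hf.smooth.ofFun, hf.smooth'.ofFun, fun t ht x =>
    (ContinuousAlternatingMap.constOfIsEmptyLIE ℝ C3 ℂ
      (Fin 0)).toContinuousLinearEquiv.toContinuousLinearMap.hasFDerivAt.comp_hasDerivWithinAt t
        (hf.deriv t ht x).ofReal_comp⟩

theorem HasTimeDeriv.inChart {α α' : ℝ → CForm X k} (h : HasTimeDeriv α α') {t : ℝ}
    (ht : t ∈ Set.Icc (0 : ℝ) 1) (c : X) (z : C3) :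
    HasDerivWithinAt (fun s => (α s).inChart c z) ((α' t).inChart c z) (Set.Icc 0 1) t :=
  hasDerivWithinAt_clm_comp (V := C3 [⋀^Fin k]→L[ℝ] ℂ) (W := C3 [⋀^Fin k]→L[ℝ] ℂ)
    (ContinuousAlternatingMap.compContinuousLinearMapCLM
      (fderiv ℝ (chartAt C3 ((chartAt C3 c).symm z) ∘ (chartAt C3 c).symm) z))
    (h.deriv t ht ((chartAt C3 c).symm z))

variable [IsManifold 𝓘(ℂ, C3) ω X]

theorem IsSmoothFamily.dOp {α : ℝ → CForm X k} (b : ℂ) (hα : IsSmoothFamily α) :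
    IsSmoothFamily fun t => dOp b (α t) := fun c => by
  let T := ContinuousAlternatingMap.alternatizeUncurryFinCLM ℝ C3 ℂ ∘L twist b k
  have h := ContDiffOn.continuousLinearMap_comp (E := ℝ × C3)
    (F := C3 →L[ℝ] C3 [⋀^Fin k]→L[ℝ] ℂ) T
    (contDiffOn_fderiv_slice (chartAt C3 c).open_target (hα c))
  exact h.congr fun p hp => inChart_dOp b (hα.isSmooth hp.1) c hp.2

/-- Time and space derivatives commute, by `hasDerivWithinAt_fderiv_slice` in the preferred chart at
each point; the rest of `dOp` is a fixed continuous linear map. -/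
theorem HasTimeDeriv.dOp {α α' : ℝ → CForm X k} (b : ℂ) (h : HasTimeDeriv α α') :
    HasTimeDeriv (fun t => dOp b (α t)) (fun t => dOp b (α' t)) :=
  ⟨h.smooth.dOp b, h.smooth'.dOp b, fun t ht x => by
    have hx := mem_chart_target C3 x
    have h1 := hasDerivWithinAt_fderiv_slice (chartAt C3 x).open_target (h.smooth x) ht hx
    have he : (fun w => derivWithin (fun s => (α s).inChart x w) (Set.Icc 0 1) t) =
        (α' t).inChart x := by
      funext w
      exact (h.inChart ht x w).derivWithin (uniqueDiffOn_Icc zero_lt_one _ ht)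
    rw [he] at h1
    let T := ContinuousAlternatingMap.alternatizeUncurryFinCLM ℝ C3 ℂ ∘L twist b k
    exact hasDerivWithinAt_clm_comp (V := C3 →L[ℝ] C3 [⋀^Fin k]→L[ℝ] ℂ) T h1⟩

theorem IsSmooth.dOp {α : CForm X k} (b : ℂ) (hα : α.IsSmooth) : (dOp b α).IsSmooth :=
  isSmooth_of_family (hα.family.dOp b)

theorem dOp_anticomm {α : CForm X k} (hα : α.IsSmooth) (b b' : ℂ) :
    CForm.dOp b (CForm.dOp b' α) + CForm.dOp b' (CForm.dOp b α) = 0 := by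
  funext x
  have hx := mem_chart_target C3 x
  have he : ∀ b, (CForm.dOp b α).inChart x =ᶠ[nhds (chartAt C3 x x)] dModel b (α.inChart x) := by
    intro b
    filter_upwards [(chartAt C3 x).open_target.mem_nhds hx] with z hz using inChart_dOp b hα x hz
  have h := dModel_anticomm b b' (((hα x).contDiffAt
    ((chartAt C3 x).open_target.mem_nhds hx)).of_le (WithTop.coe_le_coe.2 le_top))
  change dModel b _ _ + dModel b' _ _ = 0
  rw [dModel_congr b (he b'), dModel_congr b' (he b), h]

theorem dOp_dOp_self {α : CForm X k} (hα : α.IsSmooth) (b : ℂ) :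
    CForm.dOp b (CForm.dOp b α) = 0 := by
  have h := dOp_anticomm hα b b
  rw [← two_smul ℂ] at h
  exact (smul_eq_zero.1 h).resolve_left two_ne_zero

end Families

end CForm

end

noncomputable section

open MeasureTheory

namespace CForm

/-! ### Smooth functions in charts -/

section SmoothFun

variable {X : Type*} [TopologicalSpace X] [ChartedSpace C3 X] [IsManifold 𝓘(ℂ, C3) ω X]

theorem isSmoothFunFamily_of_contMDiffOn {Φ : ℝ → X → ℝ}
    (h : ContMDiffOn (𝓘(ℝ, ℝ).prod 𝓘(ℝ, C3)) 𝓘(ℝ, ℝ) ∞ (fun p : ℝ × X => Φ p.1 p.2)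
      (Set.Icc 0 1 ×ˢ Set.univ)) : IsSmoothFunFamily Φ := fun c => by
  have := isManifold_real X
  have h1 : ContMDiffOn (𝓘(ℝ, ℝ).prod 𝓘(ℝ, C3)) 𝓘(ℝ, C3) ∞
      (fun p : ℝ × C3 => (chartAt C3 c).symm p.2) (Set.Icc 0 1 ×ˢ (chartAt C3 c).target) :=
    (contMDiffOn_chart_symm (I := 𝓘(ℝ, C3)) (n := ∞) (x := c)).comp contMDiffOn_snd
      fun p hp => hp.2
  have h2 := h.comp (contMDiffOn_fst.prodMk h1) fun p hp => ⟨hp.1, Set.mem_univ _⟩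
  -- Identifies the product manifold structure on `ℝ × ℂ³` with that of a normed space, so that
  -- manifold smoothness becomes `ContDiffOn`.
  rw [← modelWithCornersSelf_prod] at h2
  rw [chartedSpaceSelf_prod] at h2
  exact h2.contDiffOn

theorem isSmoothFunFamily_const {f : X → ℝ} (h : ContMDiff 𝓘(ℝ, C3) 𝓘(ℝ, ℝ) ∞ f) :
    IsSmoothFunFamily fun _ => f :=
  isSmoothFunFamily_of_contMDiffOn (h.comp contMDiff_snd).contMDiffOn

theorem IsSmooth.fmul {k : ℕ} {f : X → ℝ} {α : CForm X k} (hf : ContMDiff 𝓘(ℝ, C3) 𝓘(ℝ, ℝ) ∞ f)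
    (hα : α.IsSmooth) : (α.fmul f).IsSmooth :=
  isSmooth_of_family ((isSmoothFunFamily_const hf).fmul hα.family)

end SmoothFun

/-! ### Integration -/

section Integral

variable {X : Type*} [TopologicalSpace X] [ChartedSpace C3 X]

/-- Smooth forms. -/
def smoothForms (X : Type*) [TopologicalSpace X] [ChartedSpace C3 X] (k : ℕ) :
    Submodule ℂ (CForm X k) where
  carrier := {α | α.IsSmooth}
  add_mem' ha hb := fun c => (ha c).add (hb c)
  zero_mem' := fun _ => contDiffOn_const (c := 0)
  smul_mem' b _ ha := fun c => (ha c).const_smul b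

/-- The overlap of two charts, in the coordinates of the first. -/
def overlap (c c' : X) : Set C3 := (chartAt C3 c).target ∩ (chartAt C3 c).symm ⁻¹' (chartAt C3 c').source

theorem isOpen_overlap (c c' : X) : IsOpen (overlap c c') := by
  have := ((chartAt C3 c).symm.trans (chartAt C3 c')).open_source
  simpa [overlap, OpenPartialHomeomorph.trans_source] using this

/-- The real determinant of a complex-linear map is the squared modulus of its complex determinant.
Thus holomorphic changes of coordinates preserve orientation, and the absolute value in the change
of variables formula can be dropped. -/
theorem det_fderiv_nonneg {g : C3 → C3} {z : C3} (hg : DifferentiableAt ℂ g z) :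
    0 ≤ (fderiv ℝ g z).det := by
  rw [hg.fderiv_restrictScalars ℝ]
  change 0 ≤ LinearMap.det ((fderiv ℂ g z : C3 →ₗ[ℂ] C3).restrictScalars ℝ)
  rw [LinearMap.det_restrictScalars, Algebra.norm_complex_eq]
  exact Complex.normSq_nonneg _

variable [IsManifold 𝓘(ℂ, C3) ω X]

/-- Change of variables: the Jacobian is exactly the factor by which a top form changes under
pullback by the transition map. -/
theorem setIntegral_overlap (γ : CForm X 6) (c c' : X) :
    ∫ z in overlap c' c, γ.inChart c' z stdFrame = ∫ z in overlap c c', γ.inChart c z stdFrame := by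
  set g : C3 → C3 := chartAt C3 c' ∘ (chartAt C3 c).symm with hgdef
  have hg : ∀ z ∈ overlap c c', ContDiffAt ℂ ω g z := fun z hz =>
    contDiffAt_transition c c' hz.1 hz.2
  have himg : g '' overlap c c' = overlap c' c := by
    ext w
    constructor
    · rintro ⟨z, hz, rfl⟩
      refine ⟨(chartAt C3 c').map_source hz.2, ?_⟩
      simp only [hgdef, Set.mem_preimage, Function.comp_apply, (chartAt C3 c').left_inv hz.2]
      exact (chartAt C3 c).map_target hz.1
    · intro hw
      refine ⟨chartAt C3 c ((chartAt C3 c').symm w), ⟨(chartAt C3 c).map_source hw.2, ?_⟩, ?_⟩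
      · simp only [Set.mem_preimage, (chartAt C3 c).left_inv hw.2]
        exact (chartAt C3 c').map_target hw.1
      · simp only [hgdef, Function.comp_apply, (chartAt C3 c).left_inv hw.2,
          (chartAt C3 c').right_inv hw.1]
  have hinj : Set.InjOn g (overlap c c') := by
    intro z hz w hw h
    have h1 := (chartAt C3 c').injOn hz.2 hw.2 h
    exact (chartAt C3 c).symm.injOn hz.1 hw.1 h1
  rw [← himg, integral_image_eq_integral_abs_det_fderiv_smul volume
    (isOpen_overlap c c').measurableSet
    (fun z hz => (((hg z hz).restrict_scalars ℝ).differentiableAt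
      (by simp)).hasFDerivAt.hasFDerivWithinAt) hinj]
  refine setIntegral_congr_fun (isOpen_overlap c c').measurableSet fun z hz => ?_
  have h1 := inChart_transition γ c c' hz.1 hz.2
  change |(fderiv ℝ g z).det| • γ.inChart c' (g z) stdFrame = _
  rw [h1, compContinuousLinearMap_stdFrame,
    abs_of_nonneg (det_fderiv_nonneg ((hg z hz).differentiableAt (by simp)))]
  rfl

variable [T2Space X] [CompactSpace X]

theorem finite_chartPartition_ne_zero : {c : X | (chartPartition X c : X → ℝ) ≠ 0}.Finite := by
  have h := (chartPartition X).locallyFinite.finite_nonempty_of_compact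
  refine h.subset fun c hc => ?_
  simpa [Function.support_nonempty_iff] using hc

/-- The charts used for integration. -/
def chartIndex (X : Type*) [TopologicalSpace X] [ChartedSpace C3 X] [IsManifold 𝓘(ℂ, C3) ω X]
    [T2Space X] [CompactSpace X] : Finset X := (finite_chartPartition_ne_zero (X := X)).toFinset

theorem chartPartition_eq_zero {c : X} (hc : c ∉ chartIndex X) (x : X) :
    chartPartition X c x = 0 := by
  by_contra h
  refine hc ((Set.Finite.mem_toFinset _).2 fun h0 => h ?_)
  exact congrFun h0 x

theorem sum_chartPartition (x : X) : ∑ c ∈ chartIndex X, chartPartition X c x = 1 := by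
  rw [← (chartPartition X).sum_eq_one (Set.mem_univ x)]
  refine (finsum_eq_sum_of_support_subset _ fun c hc => ?_).symm
  by_contra h
  exact hc (chartPartition_eq_zero h x)

/-- The support of the partition function at `c`, in coordinates. -/
def chartSupport (c : X) : Set C3 := chartAt C3 c '' tsupport (chartPartition X c)

theorem tsupport_chartPartition_subset (c : X) :
    tsupport (chartPartition X c) ⊆ (chartAt C3 c).source := chartPartition_isSubordinate X c

theorem chartSupport_subset (c : X) : chartSupport c ⊆ (chartAt C3 c).target := by
  rintro _ ⟨x, hx, rfl⟩
  exact (chartAt C3 c).map_source (tsupport_chartPartition_subset c hx)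

theorem isCompact_chartSupport (c : X) : IsCompact (chartSupport c) :=
  (isClosed_tsupport _).isCompact.image_of_continuousOn
    ((chartAt C3 c).continuousOn.mono (tsupport_chartPartition_subset c))

theorem symm_notMem_tsupport {c : X} {z : C3} (hz : z ∈ (chartAt C3 c).target)
    (hz' : z ∉ chartSupport c) : (chartAt C3 c).symm z ∉ tsupport (chartPartition X c) := fun h =>
  hz' ⟨_, h, (chartAt C3 c).right_inv hz⟩

theorem chartPartition_symm_eq_zero {c : X} {z : C3} (hz : z ∈ (chartAt C3 c).target)
    (hz' : z ∉ chartSupport c) : chartPartition X c ((chartAt C3 c).symm z) = 0 :=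
  image_eq_zero_of_notMem_tsupport (symm_notMem_tsupport hz hz')

theorem integral_eq_sum_target (γ : CForm X 6) :
    γ.integral = ∑ c ∈ chartIndex X, ∫ z in (chartAt C3 c).target,
      (chartPartition X c ((chartAt C3 c).symm z) : ℂ) * γ.inChart c z stdFrame := by
  refine finsum_eq_sum_of_support_subset _ fun c hc => ?_
  by_contra h
  exact hc (by simp [chartPartition_eq_zero h])

/-- Shrinking the domain to the compact set `chartSupport c` makes integrability automatic: the
integrands of smooth forms are continuous there. -/
theorem integral_eq_sum (γ : CForm X 6) :
    γ.integral = ∑ c ∈ chartIndex X, ∫ z in chartSupport c,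
      (chartPartition X c ((chartAt C3 c).symm z) : ℂ) * γ.inChart c z stdFrame := by
  rw [integral_eq_sum_target]
  refine Finset.sum_congr rfl fun c _ => ?_
  refine setIntegral_eq_of_subset_of_forall_sdiff_eq_zero (chartAt C3 c).open_target.measurableSet
    (chartSupport_subset c) fun z hz => ?_
  rw [chartPartition_symm_eq_zero hz.1 hz.2]
  simp

theorem continuousOn_integrand {α : ℝ → CForm X 6} (h : IsSmoothFamily α) (c : X) :
    ContinuousOn (fun p : ℝ × C3 => (chartPartition X c ((chartAt C3 c).symm p.2) : ℂ) *
      (α p.1).inChart c p.2 stdFrame) (Set.Icc 0 1 ×ˢ (chartAt C3 c).target) := by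
  refine ContinuousOn.mul ?_ ?_
  · refine Complex.continuous_ofReal.comp_continuousOn ((chartPartition X c).contMDiff.continuous.comp_continuousOn
      ((chartAt C3 c).symm.continuousOn.comp continuousOn_snd fun p hp => hp.2))
  · exact (ContinuousAlternatingMap.apply ℝ C3 ℂ stdFrame).continuous.comp_continuousOn
      (h c).continuousOn

theorem integrableOn_prod {α : ℝ → CForm X 6} (h : IsSmoothFamily α) (c : X) :
    Integrable (fun p : ℝ × C3 => (chartPartition X c ((chartAt C3 c).symm p.2) : ℂ) *
      (α p.1).inChart c p.2 stdFrame)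
      ((volume.restrict (Set.Ioc (0 : ℝ) 1)).prod (volume.restrict (chartSupport c))) := by
  rw [Measure.prod_restrict, ← Measure.volume_eq_prod]
  refine IntegrableOn.mono_set (t := Set.Icc (0 : ℝ) 1 ×ˢ chartSupport c) ?_
    (Set.prod_mono Set.Ioc_subset_Icc_self subset_rfl)
  exact ((continuousOn_integrand h c).mono (Set.prod_mono subset_rfl
    (chartSupport_subset c))).integrableOn_compact (isCompact_Icc.prod (isCompact_chartSupport c))

theorem IsSmooth.integrableOn {γ : CForm X 6} (h : γ.IsSmooth) (c : X) :
    IntegrableOn (fun z => (chartPartition X c ((chartAt C3 c).symm z) : ℂ) *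
      γ.inChart c z stdFrame) (chartSupport c) := by
  refine ContinuousOn.integrableOn_compact (isCompact_chartSupport c) ?_
  exact (continuousOn_integrand h.family c).comp (f := fun z : C3 => ((0 : ℝ), z))
    (continuousOn_const.prodMk continuousOn_id) fun z hz => ⟨by simp, chartSupport_subset c hz⟩

theorem integral_add {α β : CForm X 6} (hα : α.IsSmooth) (hβ : β.IsSmooth) :
    (α + β).integral = α.integral + β.integral := by
  simp only [integral_eq_sum]
  rw [← Finset.sum_add_distrib]
  refine Finset.sum_congr rfl fun c _ => ?_
  rw [← MeasureTheory.integral_add (hα.integrableOn c) (hβ.integrableOn c)]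
  simp only [← mul_add]
  rfl

theorem integral_smul (b : ℂ) (α : CForm X 6) : (b • α).integral = b * α.integral := by
  simp only [integral_eq_sum, Finset.mul_sum, ← MeasureTheory.integral_const_mul]
  simp only [mul_left_comm b]
  rfl

/-- The integral as a linear functional on smooth forms of top degree. -/
def integralL (X : Type*) [TopologicalSpace X] [ChartedSpace C3 X] [IsManifold 𝓘(ℂ, C3) ω X]
    [T2Space X] [CompactSpace X] : smoothForms X 6 →ₗ[ℂ] ℂ where
  toFun α := (α : CForm X 6).integral
  map_add' α β := integral_add α.2 β.2
  map_smul' b α := integral_smul b _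

theorem IsSmoothFamily.intervalIntegrable_integral {α : ℝ → CForm X 6} (h : IsSmoothFamily α) :
    IntervalIntegrable (fun t => (α t).integral) volume 0 1 := by
  rw [intervalIntegrable_iff_integrableOn_Ioc_of_le zero_le_one]
  simp only [integral_eq_sum]
  exact integrable_finsetSum _ fun c _ => (integrableOn_prod h c).integral_prod_left

/-- The fundamental theorem of calculus for integrals of families of forms. -/
theorem HasTimeDeriv.integral_eq_sub {α α' : ℝ → CForm X 6} (h : HasTimeDeriv α α') :
    ∫ t in (0 : ℝ)..1, (α' t).integral = (α 1).integral - (α 0).integral := by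
  have h01 : ∀ t ∈ Set.Icc (0 : ℝ) 1, (α t).IsSmooth := fun t ht => h.smooth.isSmooth ht
  rw [intervalIntegral.integral_of_le zero_le_one]
  simp only [integral_eq_sum]
  rw [integral_finsetSum _ fun c _ => (integrableOn_prod h.smooth' c).integral_prod_left,
    ← Finset.sum_sub_distrib]
  refine Finset.sum_congr rfl fun c _ => ?_
  -- After Fubini the time integral is innermost, and the one-variable fundamental theorem applies
  -- at each fixed `z`.
  rw [integral_integral_swap (integrableOn_prod h.smooth' c),
    ← MeasureTheory.integral_sub ((h01 1 (by simp)).integrableOn c)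
      ((h01 0 (by simp)).integrableOn c)]
  refine setIntegral_congr_fun (isCompact_chartSupport c).measurableSet fun z hz => ?_
  have hz' := chartSupport_subset c hz
  have hcont : ∀ {β : ℝ → CForm X 6}, IsSmoothFamily β → ContinuousOn (fun t =>
      (chartPartition X c ((chartAt C3 c).symm z) : ℂ) * (β t).inChart c z stdFrame)
      (Set.Icc 0 1) := fun hβ =>
    (continuousOn_integrand hβ c).comp (f := fun t : ℝ => (t, z))
      (continuousOn_id.prodMk continuousOn_const) fun t ht => ⟨ht, hz'⟩
  simp only
  rw [← intervalIntegral.integral_of_le zero_le_one]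
  refine intervalIntegral.integral_eq_sub_of_hasDerivAt_of_le zero_le_one (hcont h.smooth)
    (fun t ht => ?_) ?_
  · have h1 := (h.inChart (Set.Ioo_subset_Icc_self ht) c z).hasDerivAt (Icc_mem_nhds ht.1 ht.2)
    have h2 := (ContinuousAlternatingMap.apply ℝ C3 ℂ stdFrame).hasFDerivAt.comp_hasDerivAt t h1
    exact h2.const_mul _
  · refine ContinuousOn.intervalIntegrable ?_
    rw [Set.uIcc_of_le zero_le_one]
    exact hcont h.smooth'

end Integral

end CForm

end

/-! ### Stokes' theorem on a compact complex three-fold. -/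

noncomputable section

open MeasureTheory

theorem dModel_zero (b : ℂ) {k : ℕ} (z : C3) :
    dModel b (fun _ : C3 => (0 : C3 [⋀^Fin k]→L[ℝ] ℂ)) z = 0 := by
  have h := dModel_const_smul b 0 (fun _ : C3 => (0 : C3 [⋀^Fin k]→L[ℝ] ℂ)) z
  have h1 : (0 : ℂ) • (fun _ : C3 => (0 : C3 [⋀^Fin k]→L[ℝ] ℂ)) = fun _ => 0 :=
    funext fun _ => smul_zero (A := C3 [⋀^Fin k]→L[ℝ] ℂ) (0 : ℂ)
  rw [h1] at h
  rw [h]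
  exact zero_smul ℂ (dModel b (fun _ : C3 => (0 : C3 [⋀^Fin k]→L[ℝ] ℂ)) z)

namespace CForm

section Stokes

variable {X : Type*} [TopologicalSpace X] [ChartedSpace C3 X]

theorem inChart_eq_zero {k : ℕ} {γ : CForm X k} {c : X} {z : C3}
    (h : γ ((chartAt C3 c).symm z) = 0) : γ.inChart c z = 0 := by
  rw [inChart, h]
  rfl

theorem continuousOn_inChart_stdFrame {γ : CForm X 6} (h : γ.IsSmooth) (c : X) :
    ContinuousOn (fun z => γ.inChart c z stdFrame) (chartAt C3 c).target :=
  (ContinuousAlternatingMap.apply ℝ C3 ℂ stdFrame).continuous.comp_continuousOn (h c).continuousOn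

theorem dOp_apply_eq_zero {k : ℕ} (b : ℂ) {γ : CForm X k} {s : Set X} (hs : IsClosed s)
    (h : ∀ x ∉ s, γ x = 0) {x : X} (hx : x ∉ s) : dOp b γ x = 0 := by
  have h1 : γ.inChart x =ᶠ[nhds (chartAt C3 x x)] fun _ => 0 := by
    have h2 : Filter.Tendsto (chartAt C3 x).symm (nhds (chartAt C3 x x)) (nhds x) := by
      have := (chartAt C3 x).continuousAt_symm (mem_chart_target C3 x)
      rwa [ContinuousAt, (chartAt C3 x).left_inv (mem_chart_source C3 x)] at this
    filter_upwards [h2 (hs.isOpen_compl.mem_nhds hx)] with z hz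
    exact inChart_eq_zero (h _ hz)
  change dModel b (γ.inChart x) _ = 0
  rw [dModel_congr b h1, dModel_zero]

theorem overlap_subset (c c' : X) : overlap c c' ⊆ (chartAt C3 c).target := Set.inter_subset_left

theorem dOp_add {k : ℕ} (b : ℂ) {α β : CForm X k} (hα : α.IsSmooth) (hβ : β.IsSmooth) :
    dOp b (α + β) = dOp b α + dOp b β := funext fun x => by
  have h : (α + β).inChart x = α.inChart x + β.inChart x := funext (inChart_add α β x)
  change dModel b ((α + β).inChart x) _ = _
  rw [h, dModel_add b (hα.differentiableAt x (mem_chart_target C3 x))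
    (hβ.differentiableAt x (mem_chart_target C3 x))]
  rfl

theorem dOp_smul {k : ℕ} (b e : ℂ) (α : CForm X k) : dOp b (e • α) = e • dOp b α :=
  funext fun x => by
  have h : (e • α).inChart x = e • α.inChart x := funext (inChart_smul e α x)
  change dModel b ((e • α).inChart x) _ = _
  rw [h, dModel_const_smul]
  rfl

variable [IsManifold 𝓘(ℂ, C3) ω X]

/-- The operator `dOp b` as a linear map on smooth forms. -/
def dOpL (X : Type*) [TopologicalSpace X] [ChartedSpace C3 X] [IsManifold 𝓘(ℂ, C3) ω X]
    (b : ℂ) (k : ℕ) : smoothForms X k →ₗ[ℂ] smoothForms X (k + 1) where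
  toFun α := ⟨dOp b (α : CForm X k), IsSmooth.dOp b α.2⟩
  map_add' α β := Subtype.ext (dOp_add b (α := (α : CForm X k)) (β := (β : CForm X k)) α.2 β.2)
  map_smul' e α := Subtype.ext (dOp_smul b e (α : CForm X k))


variable [T2Space X] [CompactSpace X]

/-- The integral of a form supported in a chart is computed in this chart. -/
theorem integral_eq_setIntegral {γ : CForm X 6} (hγ : γ.IsSmooth) (c : X)
    (h0 : ∀ x ∉ tsupport (chartPartition X c), γ x = 0) :
    γ.integral = ∫ z in chartSupport c, γ.inChart c z stdFrame := by
  -- The form `ρ_{c'} γ` is supported in both chart domains, so its integral can be moved from the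
  -- chart at `c'` to the chart at `c`. There the functions `ρ_{c'}` add up to `1`.
  have key : ∀ c' : X, (∫ z in (chartAt C3 c').target,
      (chartPartition X c' ((chartAt C3 c').symm z) : ℂ) * γ.inChart c' z stdFrame) =
      ∫ z in chartSupport c,
        (chartPartition X c' ((chartAt C3 c).symm z) : ℂ) * γ.inChart c z stdFrame := by
    intro c'
    have hδ : ∀ (d : X) (z : C3), (γ.fmul (chartPartition X c')).inChart d z stdFrame =
        (chartPartition X c' ((chartAt C3 d).symm z) : ℂ) * γ.inChart d z stdFrame := by
      intro d z
      rw [inChart_fmul]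
      exact Complex.real_smul
    simp only [← hδ]
    have h1 := setIntegral_overlap (γ.fmul (chartPartition X c')) c c'
    rw [setIntegral_eq_of_subset_of_forall_sdiff_eq_zero (chartAt C3 c').open_target.measurableSet
      (overlap_subset c' c), h1,
      ← setIntegral_eq_of_subset_of_forall_sdiff_eq_zero (chartAt C3 c).open_target.measurableSet
      (overlap_subset c c'),
      setIntegral_eq_of_subset_of_forall_sdiff_eq_zero (chartAt C3 c).open_target.measurableSet
      (chartSupport_subset c)]
    · intro z hz
      rw [hδ, inChart_eq_zero (h0 _ (symm_notMem_tsupport hz.1 hz.2))]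
      exact mul_zero _
    · intro z hz
      rw [hδ, image_eq_zero_of_notMem_tsupport (f := chartPartition X c')
        fun h => hz.2 ⟨hz.1, tsupport_chartPartition_subset c' h⟩, Complex.ofReal_zero, zero_mul]
    · intro z hz
      rw [hδ, inChart_eq_zero (h0 _ fun h => hz.2 ⟨hz.1, tsupport_chartPartition_subset c h⟩)]
      exact mul_zero _
  rw [integral_eq_sum_target, Finset.sum_congr rfl fun c' _ => key c', ← integral_finsetSum]
  · refine setIntegral_congr_fun (isCompact_chartSupport c).measurableSet fun z hz => ?_
    have h1 := congrArg (fun r : ℝ => (r : ℂ)) (sum_chartPartition ((chartAt C3 c).symm z))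
    simp only [Complex.ofReal_sum, Complex.ofReal_one] at h1
    change ∑ c' ∈ chartIndex X, _ * _ = _
    rw [← Finset.sum_mul, h1, one_mul]
  · intro c' _
    refine ContinuousOn.integrableOn_compact (isCompact_chartSupport c) (ContinuousOn.mul ?_
      ((continuousOn_inChart_stdFrame hγ c).mono (chartSupport_subset c)))
    exact Complex.continuous_ofReal.comp_continuousOn
      ((chartPartition X c').contMDiff.continuous.comp_continuousOn
      ((chartAt C3 c).symm.continuousOn.mono (chartSupport_subset c)))

/-- A form supported inside one chart becomes, after extension by zero, a compactly supported form
on `ℂ³`, where `integral_dModel_eq_zero` applies. -/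
theorem integral_dOp_fmul_chartPartition (b : ℂ) {α : CForm X 5} (hα : α.IsSmooth) (c : X) :
    (dOp b (α.fmul (chartPartition X c))).integral = 0 := by
  set β : CForm X 5 := α.fmul (chartPartition X c) with hβ
  have hsm : β.IsSmooth := hα.fmul (chartPartition X c).contMDiff
  have h0 : ∀ x ∉ tsupport (chartPartition X c), β x = 0 := fun x hx => by
    change ((chartPartition X c x : ℝ) : ℂ) • α x = 0
    rw [image_eq_zero_of_notMem_tsupport hx, Complex.ofReal_zero]
    exact zero_smul ℂ (α x)
  rw [integral_eq_setIntegral (hsm.dOp b) c fun x hx =>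
    dOp_apply_eq_zero b (isClosed_tsupport _) h0 hx]
  set a : C3 → C3 [⋀^Fin 5]→L[ℝ] ℂ := (chartSupport c).indicator (β.inChart c) with ha
  have hK : IsClosed (chartSupport c) := (isCompact_chartSupport c).isClosed
  have haeq : ∀ z ∈ (chartAt C3 c).target, a z = β.inChart c z := fun z hz => by
    by_cases h : z ∈ chartSupport c
    · rw [ha, Set.indicator_of_mem h]
    · rw [ha, Set.indicator_of_notMem h, inChart_eq_zero (h0 _ (symm_notMem_tsupport hz h))]
  have hzero : ∀ z ∉ chartSupport c, a =ᶠ[nhds z] fun _ => 0 := fun z hz => by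
    filter_upwards [hK.isOpen_compl.mem_nhds hz] with w hw
    exact Set.indicator_of_notMem hw _
  have hsupp : HasCompactSupport a :=
    HasCompactSupport.intro (isCompact_chartSupport c) fun z hz => (hzero z hz).eq_of_nhds
  have hda : ∀ z, z ∈ chartSupport c → dModel b a z = (dOp b β).inChart c z := fun z hz => by
    rw [inChart_dOp b hsm c (chartSupport_subset c hz)]
    refine dModel_congr b ?_
    filter_upwards [(chartAt C3 c).open_target.mem_nhds (chartSupport_subset c hz)] with w hw
    exact haeq w hw
  have hda0 : ∀ z ∉ chartSupport c, dModel b a z = 0 := fun z hz => by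
    rw [dModel_congr b (hzero z hz), dModel_zero]
  have hcd : ContDiff ℝ 1 a := by
    rw [contDiff_iff_contDiffAt]
    intro z
    by_cases hz : z ∈ chartSupport c
    · have ht := (chartAt C3 c).open_target.mem_nhds (chartSupport_subset c hz)
      refine (((hsm c).contDiffAt ht).of_le (by simp)).congr_of_eventuallyEq ?_
      filter_upwards [ht] with w hw
      exact haeq w hw
    · exact contDiffAt_const.congr_of_eventuallyEq (hzero z hz)
  rw [← integral_dModel_eq_zero b hcd hsupp, setIntegral_congr_fun
    (isCompact_chartSupport c).measurableSet fun z hz => by rw [← hda z hz]]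
  refine setIntegral_eq_integral_of_forall_compl_eq_zero fun z hz => ?_
  rw [hda0 z hz]
  rfl

/-- Stokes' theorem. -/
theorem integral_dOp (b : ℂ) {α : CForm X 5} (hα : α.IsSmooth) : (dOp b α).integral = 0 := by
  set A : X → smoothForms X 5 := fun c =>
    ⟨α.fmul (chartPartition X c), hα.fmul (chartPartition X c).contMDiff⟩ with hA
  -- The decomposition `α = ∑ ρ_c α` is stated in the module of smooth forms, where both the
  -- differential and the integral are linear.
  have h1 : (⟨α, hα⟩ : smoothForms X 5) = ∑ c ∈ chartIndex X, A c := by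
    refine Subtype.ext (funext fun x => ?_)
    rw [AddSubmonoidClass.coe_finsetSum, Finset.sum_apply]
    change α x = ∑ c ∈ chartIndex X, ((chartPartition X c x : ℝ) : ℂ) • α x
    rw [← Finset.sum_smul, ← Complex.ofReal_sum, sum_chartPartition, Complex.ofReal_one, one_smul]
  have h2 : integralL X (dOpL X b 5 ⟨α, hα⟩) = 0 := by
    rw [h1, map_sum, map_sum]
    exact Finset.sum_eq_zero fun c _ => integral_dOp_fmul_chartPartition b hα c
  exact h2

end Stokes

end CForm

end

noncomputable section

/-- Used to extend the integral from smooth `6`-forms to all functions with values in the exterior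
algebra. -/
theorem exists_extend_of_injective {K M V : Type*} [Field K] [AddCommMonoid M] [Module K M]
    [AddCommGroup V] [Module K V] (T : M →ₗ[K] V) (hT : Function.Injective T) (f : M →ₗ[K] K) :
    ∃ g : V →ₗ[K] K, ∀ m, g (T m) = f m := by
  obtain ⟨g, hg⟩ := LinearMap.exists_extend
    (f ∘ₗ (LinearEquiv.ofInjective T hT).symm.toLinearMap)
  refine ⟨g, fun m => ?_⟩
  have h := LinearMap.congr_fun hg (LinearEquiv.ofInjective T hT m)
  rw [LinearMap.comp_apply, LinearMap.comp_apply, LinearEquiv.coe_coe,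
    LinearEquiv.symm_apply_apply] at h
  exact h

namespace CForm

/-! ### Forms as functions with values in the exterior algebra -/

section Symbol

variable {X : Type*} {k l : ℕ}

/-- The function with values in the exterior algebra defined by a form. -/
def symbol : CForm X k →ₗ[ℂ] (X → ExtAlg) where
  toFun α x := symb (α x)
  map_add' α β := funext fun x => map_add symb (α x) (β x)
  map_smul' b α := funext fun x => map_smul symb b (α x)

theorem symbol_injective : Function.Injective (symbol : CForm X k → X → ExtAlg) :=
  fun _ _ h => funext fun x => symb_injective k (congrFun h x)

theorem symbol_wedge (α : CForm X k) (β : CForm X l) :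
    symbol (α ⋏ β) = symbol α * symbol β := funext fun x => symb_wedgeAt (α x) (β x)

theorem symbol_mem_center (hk : Even k) (α : CForm X k) :
    symbol α ∈ Subalgebra.center ℂ (X → ExtAlg) := by
  rw [Subalgebra.mem_center_iff]
  exact fun r => funext fun x => Subalgebra.mem_center_iff.1 (symb_mem_center hk (α x)) (r x)

theorem symbol_fmul (f : X → ℝ) (α : CForm X k) :
    symbol (α.fmul f) = symbol (ofFun fun x => (f x : ℂ)) * symbol α := funext fun x => by
  change symb ((f x : ℂ) • α x) = symb (ContinuousAlternatingMap.constOfIsEmpty ℝ C3 (Fin 0) _) * _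
  rw [symb_constOfIsEmpty, map_smul, Algebra.smul_def]
  rfl

theorem symbol_one : symbol (ofFun fun _ : X => (1 : ℂ)) = 1 := funext fun x => by
  change symb (ContinuousAlternatingMap.constOfIsEmpty ℝ C3 (Fin 0) _) = 1
  rw [symb_constOfIsEmpty, map_one]

theorem symbol_wpow (α : CForm X 2) (i : ℕ) : symbol (α.wpow i) = symbol α ^ i := by
  induction i with
  | zero => rw [pow_zero]; exact symbol_one
  | succ i ih => rw [pow_succ, ← ih, ← symbol_wedge]; rfl

theorem symbol_anticomm (hk : Odd k) (hl : Odd l) (α : CForm X k) (β : CForm X l) :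
    symbol α * symbol β = -(symbol β * symbol α) := funext fun x => by
  change symb (α x) * symb (β x) = -(symb (β x) * symb (α x))
  rw [symb_mul_symb, (hk.mul hl).neg_one_pow, neg_one_smul]

theorem symbol_mul_self (hk : Odd k) (α : CForm X k) : symbol α * symbol α = 0 := by
  have h := symbol_anticomm hk hk α α
  rw [eq_neg_iff_add_eq_zero, ← two_smul ℂ] at h
  exact (smul_eq_zero.1 h).resolve_left two_ne_zero

variable [TopologicalSpace X] [ChartedSpace C3 X]

theorem symbol_dOp_wedge (b : ℂ) {α : CForm X k} {β : CForm X l} (hα : α.IsSmooth)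
    (hβ : β.IsSmooth) : symbol (dOp b (α ⋏ β)) =
      symbol (dOp b α) * symbol β + (-1 : ℂ) ^ k • (symbol α * symbol (dOp b β)) :=
  funext fun x => by
  have h : (α ⋏ β).inChart x = fun z => wedgeAt (α.inChart x z) (β.inChart x z) :=
    funext (inChart_wedge α β x)
  change symb (dModel b ((α ⋏ β).inChart x) _) = _
  rw [h, symb_dModel_wedgeAt b (hα.differentiableAt x (mem_chart_target C3 x))
    (hβ.differentiableAt x (mem_chart_target C3 x)), inChart_self, inChart_self]
  rfl

/-- Forms whose degrees are equal only propositionally, such as `k` and `0 + k`, are compared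
through their symbols instead of casts. -/
theorem symbol_dOp_congr (b : ℂ) {α : CForm X k} {β : CForm X l}
    (h : symbol α = symbol β) (hkl : k = l) : symbol (dOp b α) = symbol (dOp b β) := by
  subst hkl
  rw [symbol_injective h]

theorem symbol_dOp_fmul (b : ℂ) {f : X → ℝ} {α : CForm X k}
    (hf : (ofFun fun x => (f x : ℂ)).IsSmooth) (hα : α.IsSmooth) : symbol (dOp b (α.fmul f)) =
      symbol (dOp b (ofFun fun x => (f x : ℂ))) * symbol α +
        symbol (ofFun fun x => (f x : ℂ)) * symbol (dOp b α) := by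
  rw [symbol_dOp_congr b ((symbol_fmul f α).trans (symbol_wedge _ _).symm) (zero_add k).symm,
    symbol_dOp_wedge b hf hα, pow_zero, one_smul]

variable [IsManifold 𝓘(ℂ, C3) ω X] [T2Space X] [CompactSpace X]

/-- An arbitrary linear extension suffices: only its values on symbols of smooth `6`-forms are
prescribed, and terms of different shapes of degree (`2 * 3`, `2 + 2 + 1 + 1`, …) can then be added
inside one functional. -/
theorem exists_symbol_integral (X : Type*) [TopologicalSpace X] [ChartedSpace C3 X]
    [IsManifold 𝓘(ℂ, C3) ω X] [T2Space X] [CompactSpace X] :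
    ∃ L : (X → ExtAlg) →ₗ[ℂ] ℂ, ∀ α : CForm X 6, α.IsSmooth → L (symbol α) = α.integral := by
  let T : smoothForms X 6 →ₗ[ℂ] (X → ExtAlg) := symbol ∘ₗ (smoothForms X 6).subtype
  obtain ⟨g, hg⟩ := exists_extend_of_injective T
    (fun α β h => Subtype.ext (symbol_injective h)) (integralL X)
  exact ⟨g, fun α hα => hg ⟨α, hα⟩⟩

/-- The integral as a functional on functions with values in the exterior algebra. -/
def symbolIntegral (X : Type*) [TopologicalSpace X] [ChartedSpace C3 X]
    [IsManifold 𝓘(ℂ, C3) ω X] [T2Space X] [CompactSpace X] : (X → ExtAlg) →ₗ[ℂ] ℂ :=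
  Classical.choose (exists_symbol_integral X)

theorem integral_eq_symbolIntegral {α : CForm X k} (hα : α.IsSmooth) (hk : k = 6) :
    α.integral hk = symbolIntegral X (symbol α) := by
  subst hk
  exact (Classical.choose_spec (exists_symbol_integral X) α hα).symm

theorem symbolIntegral_dOp (b : ℂ) {α : CForm X k} (hα : α.IsSmooth) (hk : k = 5) :
    symbolIntegral X (symbol (dOp b α)) = 0 := by
  subst hk
  rw [← integral_eq_symbolIntegral (hα.dOp b) rfl, integral_dOp b hα]

end Symbol

end CForm

end

noncomputable section

/-! ### The algebraic identity behind the independence of the path -/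

section Algebra

/-- The derivative of `W ^ i` in the direction `W'`. -/
def powDeriv {R : Type*} [Semiring R] (W W' : R) : ℕ → R
  | 0 => 0
  | i + 1 => W ^ i * W' + powDeriv W W' i * W

/-- The dictionary is `f = φ`, `g = φ̇`, `w = Ω`, `W = Ω_φ`, `h = ∂∂̄φ`, `k = ∂∂̄φ̇`, `m = ∂∂̄Ω`, `a
= ∂φ`, `b = ∂̄φ`, `p = ∂φ̇`, `q = ∂̄φ̇`, `A = ∂Ω`, `B = ∂̄Ω`. The left side is the derivative of
`energy` minus four times the integrand. Each line on the right is a multiple of the Leibniz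
expansion of `∂̄` (first eight lines) or `∂` (last seven) of a product such as `f w w p`; the zeros
stand for second derivatives that vanish. Even letters are scalars from a commutative ring `E`, so
once the odd letters are sorted the identity can be checked coefficient by coefficient. -/
theorem energy_deriv_sub_eq_aux {R E : Type*} [Ring R] [Algebra ℂ R] [CommRing E] [Algebra ℂ E]
    [Module E R] [IsScalarTower ℂ E R] [IsScalarTower E R R]
    (hcomm : ∀ (r : E) (x y : R), x * r • y = r • (x * y)) {f g w h k m : E} {a b p q A B : R}
    (P : R → Prop) (hP : ∀ x y, P x → P y → x * y = -(y * x))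
    (ha : P a) (hb : P b) (hp : P p) (hq : P q) (hA : P A) (hB : P B)
    {W : R} (hW : W = w • (1 : R) + Complex.I • h • (1 : R)) :
    (∑ i : Fin 4, ((g • (1 : R)) * (W ^ (i : ℕ) * (w • (1 : R)) ^ (3 - (i : ℕ))) +
        (f • (1 : R)) * (powDeriv W (Complex.I • (k • (1 : R))) i * (w • (1 : R)) ^ (3 - (i : ℕ)))))
      - (2 : ℂ) • (∑ i : Fin 2, ((i : ℕ) + 1 : ℂ) •
        ((g • (1 : R)) * (W ^ (i : ℕ) * (w • (1 : R)) ^ (1 - (i : ℕ)) * (Complex.I • A) * b) +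
        (f • (1 : R)) * (W ^ (i : ℕ) * (w • (1 : R)) ^ (1 - (i : ℕ)) * (Complex.I • A) * q +
          powDeriv W (Complex.I • (k • (1 : R))) i * (w • (1 : R)) ^ (1 - (i : ℕ)) * (Complex.I • A) * b)))
      + (2 : ℂ) • (∑ i : Fin 2, ((i : ℕ) + 1 : ℂ) •
        ((g • (1 : R)) * (W ^ (i : ℕ) * (w • (1 : R)) ^ (1 - (i : ℕ)) * (Complex.I • B) * a) +
        (f • (1 : R)) * (W ^ (i : ℕ) * (w • (1 : R)) ^ (1 - (i : ℕ)) * (Complex.I • B) * p +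
          powDeriv W (Complex.I • (k • (1 : R))) i * (w • (1 : R)) ^ (1 - (i : ℕ)) * (Complex.I • B) * a)))
      - (4 : ℂ) • ((g • (1 : R)) * W ^ 3 - (3 * Complex.I) • (A * ((f • (1 : R)) * q) * W) +
        (3 * Complex.I) • (B * ((f • (1 : R)) * p) * W) + a * b * A * q + b * a * B * p) =
    (-3 * Complex.I) • (b * ((w • (1 : R)) * (w • (1 : R)) * p) + (f • (1 : R)) * ((B * (w • (1 : R)) + (w • (1 : R)) * B) * p + (w • (1 : R)) * (w • (1 : R)) * (-(k • (1 : R)))))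
      + (4 : ℂ) • (b * ((w • (1 : R)) * (h • (1 : R)) * p) + (f • (1 : R)) * ((B * (h • (1 : R)) + (w • (1 : R)) * 0) * p + (w • (1 : R)) * (h • (1 : R)) * (-(k • (1 : R)))))
      + (4 : ℂ) • (b * ((w • (1 : R)) * (k • (1 : R)) * a) + (f • (1 : R)) * ((B * (k • (1 : R)) + (w • (1 : R)) * 0) * a + (w • (1 : R)) * (k • (1 : R)) * (-(h • (1 : R)))))
      + (4 : ℂ) • (b * (a * p * B) + (f • (1 : R)) * ((-(h • (1 : R)) * p - a * (-(k • (1 : R)))) * B + a * p * 0))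
      - (4 : ℂ) • (b * (a * q * A) + (f • (1 : R)) * ((-(h • (1 : R)) * q - a * 0) * A + a * q * (-(m • (1 : R)))))
      + (3 * Complex.I) • (q * ((w • (1 : R)) * (w • (1 : R)) * a) + (g • (1 : R)) * ((B * (w • (1 : R)) + (w • (1 : R)) * B) * a + (w • (1 : R)) * (w • (1 : R)) * (-(h • (1 : R)))))
      - (4 : ℂ) • (q * ((w • (1 : R)) * (h • (1 : R)) * a) + (g • (1 : R)) * ((B * (h • (1 : R)) + (w • (1 : R)) * 0) * a + (w • (1 : R)) * (h • (1 : R)) * (-(h • (1 : R)))))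
      - (3 * Complex.I) • (q * ((h • (1 : R)) * (h • (1 : R)) * a) + (g • (1 : R)) * ((0 * (h • (1 : R)) + (h • (1 : R)) * 0) * a + (h • (1 : R)) * (h • (1 : R)) * (-(h • (1 : R)))))
      + (3 * Complex.I) • (a * ((w • (1 : R)) * (w • (1 : R)) * q) + (f • (1 : R)) * ((A * (w • (1 : R)) + (w • (1 : R)) * A) * q + (w • (1 : R)) * (w • (1 : R)) * (k • (1 : R))))
      - (4 : ℂ) • (a * ((w • (1 : R)) * (h • (1 : R)) * q) + (f • (1 : R)) * ((A * (h • (1 : R)) + (w • (1 : R)) * 0) * q + (w • (1 : R)) * (h • (1 : R)) * (k • (1 : R))))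
      + (4 : ℂ) • (a * ((w • (1 : R)) * (k • (1 : R)) * b) + (f • (1 : R)) * ((A * (k • (1 : R)) + (w • (1 : R)) * 0) * b + (w • (1 : R)) * (k • (1 : R)) * (h • (1 : R))))
      - (3 * Complex.I) • (a * ((h • (1 : R)) * (h • (1 : R)) * q) + (f • (1 : R)) * ((0 * (h • (1 : R)) + (h • (1 : R)) * 0) * q + (h • (1 : R)) * (h • (1 : R)) * (k • (1 : R))))
      - (4 : ℂ) • (a * (a * q * B) + (f • (1 : R)) * ((0 * q - a * (k • (1 : R))) * B + a * q * (m • (1 : R))))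
      - (3 * Complex.I) • (p * ((w • (1 : R)) * (w • (1 : R)) * b) + (g • (1 : R)) * ((A * (w • (1 : R)) + (w • (1 : R)) * A) * b + (w • (1 : R)) * (w • (1 : R)) * (h • (1 : R))))
      + (4 : ℂ) • (p * ((w • (1 : R)) * (h • (1 : R)) * b) + (g • (1 : R)) * ((A * (h • (1 : R)) + (w • (1 : R)) * 0) * b + (w • (1 : R)) * (h • (1 : R)) * (h • (1 : R)))) := by
  -- The scalar `√-1` is carried into `E`, where `ring` treats it as a free variable; the relation
  -- `J² = -1` is then supplied by hand.
  set J : E := algebraMap ℂ _ Complex.I with hJ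
  have hJ2 : J * J = -1 := by rw [hJ, ← map_mul, Complex.I_mul_I, map_neg, map_one]
  have hsm : ∀ (c : ℂ) (x : R), c • x = (algebraMap ℂ E c) • x :=
    fun c x => (algebraMap_smul E c x).symm
  have hP' : ∀ x y z, P x → P y → x * (y * z) = -(y * (x * z)) := fun x y z hx hy => by
    rw [← mul_assoc, hP x y hx hy, neg_mul, mul_assoc]
  have haa : a * a = 0 := by
    have h1 := hP a a ha ha
    rw [eq_neg_iff_add_eq_zero, ← two_smul ℂ] at h1
    exact (smul_eq_zero.1 h1).resolve_left two_ne_zero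
  have haa' : ∀ z, a * (a * z) = 0 := fun z => by rw [← mul_assoc, haa, zero_mul]
  subst hW
  -- Everything is expanded and the odd letters are moved towards the order `a, b, p, q, A, B`, so
  -- that equal monomials become syntactically equal.
  simp only [Fin.sum_univ_four, Fin.sum_univ_two, Fin.coe_ofNat_eq_mod, Nat.reduceMod,
    Nat.reduceSub, Nat.cast_zero, Nat.cast_one, Nat.zero_mod, powDeriv, pow_succ, pow_zero,
    zero_mul, mul_zero, add_zero, zero_add, one_mul, mul_one, hsm, map_mul, map_neg, map_ofNat,
    map_natCast, map_add, map_one, ← hJ, smul_mul_assoc, hcomm, mul_add, add_mul, smul_add,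
    smul_smul, neg_mul, mul_neg, smul_neg, sub_mul, mul_sub, smul_sub, mul_assoc, hP b a hb ha,
    hP' b a _ hb ha, hP p b hp hb, hP q a hq ha, hP A b hA hb, hP A q hA hq, hP B a hB ha,
    hP B p hB hp, haa', smul_zero]
  match_scalars
  · linear_combination (-8 * h ^ 2 * w * g - 3 * J * h ^ 3 * g + 8 * h * k * w * f +
      3 * J * h ^ 2 * k * f) * hJ2
  · linear_combination (4 * g * h + 4 * f * k) * hJ2
  · linear_combination (-8 * f * h) * hJ2
  · linear_combination (-4 * g * h - 4 * f * k) * hJ2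
  · linear_combination (8 * f * h) * hJ2
  all_goals ring

/-- Here `f, g` are functions, `w, h, k` are `2`-forms, `m` a `4`-form, and `a, b, p, q, A, B` odd forms. -/
theorem energy_deriv_sub_eq {R : Type*} [Ring R] [Algebra ℂ R] {f g w h k m a b p q A B : R}
    (hf : f ∈ Subalgebra.center ℂ R) (hg : g ∈ Subalgebra.center ℂ R)
    (hw : w ∈ Subalgebra.center ℂ R) (hh : h ∈ Subalgebra.center ℂ R)
    (hk : k ∈ Subalgebra.center ℂ R) (hm : m ∈ Subalgebra.center ℂ R)
    (P : R → Prop) (hP : ∀ x y, P x → P y → x * y = -(y * x))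
    (ha : P a) (hb : P b) (hp : P p) (hq : P q) (hA : P A) (hB : P B)
    {W : R} (hW : W = w + Complex.I • h) :
    (∑ i : Fin 4, (g * (W ^ (i : ℕ) * w ^ (3 - (i : ℕ))) +
        f * (powDeriv W (Complex.I • k) i * w ^ (3 - (i : ℕ)))))
      - (2 : ℂ) • (∑ i : Fin 2, ((i : ℕ) + 1 : ℂ) •
        (g * (W ^ (i : ℕ) * w ^ (1 - (i : ℕ)) * (Complex.I • A) * b) +
        f * (W ^ (i : ℕ) * w ^ (1 - (i : ℕ)) * (Complex.I • A) * q +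
          powDeriv W (Complex.I • k) i * w ^ (1 - (i : ℕ)) * (Complex.I • A) * b)))
      + (2 : ℂ) • (∑ i : Fin 2, ((i : ℕ) + 1 : ℂ) •
        (g * (W ^ (i : ℕ) * w ^ (1 - (i : ℕ)) * (Complex.I • B) * a) +
        f * (W ^ (i : ℕ) * w ^ (1 - (i : ℕ)) * (Complex.I • B) * p +
          powDeriv W (Complex.I • k) i * w ^ (1 - (i : ℕ)) * (Complex.I • B) * a)))
      - (4 : ℂ) • (g * W ^ 3 - (3 * Complex.I) • (A * (f * q) * W) +
        (3 * Complex.I) • (B * (f * p) * W) + a * b * A * q + b * a * B * p) =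
    (-3 * Complex.I) • (b * (w * w * p) + f * ((B * w + w * B) * p + w * w * (-k)))
      + (4 : ℂ) • (b * (w * h * p) + f * ((B * h + w * 0) * p + w * h * (-k)))
      + (4 : ℂ) • (b * (w * k * a) + f * ((B * k + w * 0) * a + w * k * (-h)))
      + (4 : ℂ) • (b * (a * p * B) + f * ((-h * p - a * (-k)) * B + a * p * 0))
      - (4 : ℂ) • (b * (a * q * A) + f * ((-h * q - a * 0) * A + a * q * (-m)))
      + (3 * Complex.I) • (q * (w * w * a) + g * ((B * w + w * B) * a + w * w * (-h)))
      - (4 : ℂ) • (q * (w * h * a) + g * ((B * h + w * 0) * a + w * h * (-h)))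
      - (3 * Complex.I) • (q * (h * h * a) + g * ((0 * h + h * 0) * a + h * h * (-h)))
      + (3 * Complex.I) • (a * (w * w * q) + f * ((A * w + w * A) * q + w * w * k))
      - (4 : ℂ) • (a * (w * h * q) + f * ((A * h + w * 0) * q + w * h * k))
      + (4 : ℂ) • (a * (w * k * b) + f * ((A * k + w * 0) * b + w * k * h))
      - (3 * Complex.I) • (a * (h * h * q) + f * ((0 * h + h * 0) * q + h * h * k))
      - (4 : ℂ) • (a * (a * q * B) + f * ((0 * q - a * k) * B + a * q * m))
      - (3 * Complex.I) • (p * (w * w * b) + g * ((A * w + w * A) * b + w * w * h))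
      + (4 : ℂ) • (p * (w * h * b) + g * ((A * h + w * 0) * b + w * h * h)) := by
  -- The centre is a commutative ring acting on `R`; writing a central element as `y • 1` turns it
  -- into a scalar.
  have lift : ∀ x ∈ Subalgebra.center ℂ R,
      ∃ y : Subalgebra.center ℂ R, x = y • (1 : R) := fun x hx => ⟨⟨x, hx⟩, (mul_one x).symm⟩
  obtain ⟨f, rfl⟩ := lift f hf
  obtain ⟨g, rfl⟩ := lift g hg
  obtain ⟨w, rfl⟩ := lift w hw
  obtain ⟨h, rfl⟩ := lift h hh
  obtain ⟨k, rfl⟩ := lift k hk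
  obtain ⟨m, rfl⟩ := lift m hm
  refine energy_deriv_sub_eq_aux (fun r x y => ?_) P hP ha hb hp hq hA hB hW
  change x * (r * y) = r * (x * y)
  rw [← mul_assoc, Subalgebra.mem_center_iff.1 r.2 x, mul_assoc]

end Algebra
end

/-! ### The derivative of the closed formula at a fixed time, modulo exact forms. -/

noncomputable section

namespace CForm

section Slice

variable {X : Type*} [TopologicalSpace X] [ChartedSpace C3 X]

/-- A real function as a form of degree zero. -/
def ofReal (f : X → ℝ) : CForm X 0 := ofFun fun x => (f x : ℂ)

theorem del₀_eq (f : X → ℝ) : del₀ f = dOp (-Complex.I) (ofReal f) := del_eq_dOp _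

theorem delbar₀_eq (f : X → ℝ) : delbar₀ f = dOp Complex.I (ofReal f) := delbar_eq_dOp _

theorem deform_eq (Ω : CForm X 2) (f : X → ℝ) :
    deform Ω f = Ω + Complex.I • dOp (-Complex.I) (dOp Complex.I (ofReal f)) := by
  rw [deform, del_eq_dOp, delbar₀_eq]

theorem IsSmooth.wedge {k l : ℕ} {α : CForm X k} {β : CForm X l} (hα : α.IsSmooth)
    (hβ : β.IsSmooth) : (α ⋏ β).IsSmooth := isSmooth_of_family (hα.family.wedge hβ.family)

theorem isSmooth_fmul_of_family {k : ℕ} {f : X → ℝ} {α : CForm X k}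
    (hf : IsSmoothFunFamily fun _ => f) (hα : α.IsSmooth) : (α.fmul f).IsSmooth :=
  isSmooth_of_family (hf.fmul hα.family)

theorem isSmooth_ofReal {f : X → ℝ} (hf : IsSmoothFunFamily fun _ => f) : (ofReal f).IsSmooth :=
  isSmooth_of_family hf.ofFun

theorem IsSmoothFunFamily.slice {f : ℝ → X → ℝ} (hf : IsSmoothFunFamily f) {t : ℝ}
    (ht : t ∈ Set.Icc (0 : ℝ) 1) : IsSmoothFunFamily fun _ => f t := fun c =>
  (hf c).comp (f := fun p : ℝ × C3 => (t, p.2)) (contDiff_const.prodMk contDiff_snd).contDiffOn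
    fun _ hp => ⟨ht, hp.2⟩

theorem dOp_zero {k : ℕ} (b : ℂ) : dOp b (0 : CForm X k) = 0 := funext fun x => by
  have h : (0 : CForm X k).inChart x = fun _ => 0 := funext fun z => inChart_eq_zero rfl
  change dModel b ((0 : CForm X k).inChart x) _ = 0
  rw [h, dModel_zero]

variable [IsManifold 𝓘(ℂ, C3) ω X] [T2Space X] [CompactSpace X]

/-- Stokes' theorem for a function times forms of degrees `2, 2, 1`. The differentials are separate
variables, tied by equations, so that simplified values such as `0` or `-∂∂̄φ` can be inserted in
the exact shape of the algebraic identity. -/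
theorem symbolIntegral_dOp_two_two_one (b : ℂ) {f : X → ℝ} {α β : CForm X 2} {γ : CForm X 1}
    (hf : IsSmoothFunFamily fun _ => f) (hα : α.IsSmooth) (hβ : β.IsSmooth) (hγ : γ.IsSmooth)
    {df dα dβ dγ : X → ExtAlg} (ef : symbol (dOp b (ofReal f)) = df) (eα : symbol (dOp b α) = dα)
    (eβ : symbol (dOp b β) = dβ) (eγ : symbol (dOp b γ) = dγ) :
    symbolIntegral X (df * (symbol α * symbol β * symbol γ) + symbol (ofReal f) *
      ((dα * symbol β + symbol α * dβ) * symbol γ + symbol α * symbol β * dγ)) = 0 := by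
  rw [← symbolIntegral_dOp b (isSmooth_fmul_of_family hf ((hα.wedge hβ).wedge hγ)) rfl,
    symbol_dOp_fmul b (isSmooth_ofReal hf) ((hα.wedge hβ).wedge hγ),
    symbol_dOp_wedge b (hα.wedge hβ) hγ, symbol_dOp_wedge b hα hβ, symbol_wedge, symbol_wedge,
    ← ef, ← eα, ← eβ, ← eγ]
  simp only [Even.neg_one_pow (show Even 2 by decide), Even.neg_one_pow (show Even (2 + 2) by decide),
    one_smul]
  rfl

theorem symbolIntegral_dOp_one_one_three (b : ℂ) {f : X → ℝ} {α β : CForm X 1} {γ : CForm X 3}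
    (hf : IsSmoothFunFamily fun _ => f) (hα : α.IsSmooth) (hβ : β.IsSmooth) (hγ : γ.IsSmooth)
    {df dα dβ dγ : X → ExtAlg} (ef : symbol (dOp b (ofReal f)) = df) (eα : symbol (dOp b α) = dα)
    (eβ : symbol (dOp b β) = dβ) (eγ : symbol (dOp b γ) = dγ) :
    symbolIntegral X (df * (symbol α * symbol β * symbol γ) + symbol (ofReal f) *
      ((dα * symbol β - symbol α * dβ) * symbol γ + symbol α * symbol β * dγ)) = 0 := by
  rw [← symbolIntegral_dOp b (isSmooth_fmul_of_family hf ((hα.wedge hβ).wedge hγ)) rfl,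
    symbol_dOp_fmul b (isSmooth_ofReal hf) ((hα.wedge hβ).wedge hγ),
    symbol_dOp_wedge b (hα.wedge hβ) hγ, symbol_dOp_wedge b hα hβ, symbol_wedge, symbol_wedge,
    ← ef, ← eα, ← eβ, ← eγ]
  simp only [pow_one, Even.neg_one_pow (show Even (1 + 1) by decide), one_smul, neg_smul,
    ← sub_eq_add_neg]
  rfl

/-- At each time, the derivative of the closed formula and the integrand of the functional differ
by an exact form. -/
theorem symbolIntegral_energy_deriv {Ω : CForm X 2} (hΩ : Ω.IsSmooth) {φ ψ : X → ℝ}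
    (hφ : IsSmoothFunFamily fun _ => φ) (hψ : IsSmoothFunFamily fun _ => ψ)
    {W f g w k a b p q A B : X → ExtAlg} (hW : W = symbol (deform Ω φ))
    (hf : f = symbol (ofReal φ)) (hg : g = symbol (ofReal ψ)) (hw : w = symbol Ω)
    (hk : k = symbol (dOp (-Complex.I) (dOp Complex.I (ofReal ψ))))
    (ha : a = symbol (dOp (-Complex.I) (ofReal φ))) (hb : b = symbol (dOp Complex.I (ofReal φ)))
    (hp : p = symbol (dOp (-Complex.I) (ofReal ψ))) (hq : q = symbol (dOp Complex.I (ofReal ψ)))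
    (hA : A = symbol (dOp (-Complex.I) Ω)) (hB : B = symbol (dOp Complex.I Ω)) :
    symbolIntegral X (
    (∑ i : Fin 4, (g * (W ^ (i : ℕ) * w ^ (3 - (i : ℕ))) +
        f * (powDeriv W (Complex.I • k) i * w ^ (3 - (i : ℕ)))))
      - (2 : ℂ) • (∑ i : Fin 2, ((i : ℕ) + 1 : ℂ) •
        (g * (W ^ (i : ℕ) * w ^ (1 - (i : ℕ)) * (Complex.I • A) * b) +
        f * (W ^ (i : ℕ) * w ^ (1 - (i : ℕ)) * (Complex.I • A) * q +
          powDeriv W (Complex.I • k) i * w ^ (1 - (i : ℕ)) * (Complex.I • A) * b)))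
      + (2 : ℂ) • (∑ i : Fin 2, ((i : ℕ) + 1 : ℂ) •
        (g * (W ^ (i : ℕ) * w ^ (1 - (i : ℕ)) * (Complex.I • B) * a) +
        f * (W ^ (i : ℕ) * w ^ (1 - (i : ℕ)) * (Complex.I • B) * p +
          powDeriv W (Complex.I • k) i * w ^ (1 - (i : ℕ)) * (Complex.I • B) * a)))
      - (4 : ℂ) • (g * W ^ 3 - (3 * Complex.I) • (A * (f * q) * W) +
        (3 * Complex.I) • (B * (f * p) * W) + a * b * A * q + b * a * B * p)) = 0 := by
  have sφ := isSmooth_ofReal hφ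
  have sψ := isSmooth_ofReal hψ
  have anti : ∀ {n : ℕ} {α : CForm X n}, α.IsSmooth → symbol (dOp Complex.I (dOp (-Complex.I) α)) =
      -symbol (dOp (-Complex.I) (dOp Complex.I α)) := fun hα => by
    rw [eq_neg_iff_add_eq_zero, ← map_add, dOp_anticomm hα, map_zero]
  have self : ∀ {n : ℕ} {α : CForm X n} (e : ℂ), α.IsSmooth → symbol (dOp e (dOp e α)) = 0 :=
    fun e hα => by rw [dOp_dOp_self hα, map_zero]
  have self' : ∀ {n : ℕ} {α : CForm X n}, α.IsSmooth →
      symbol (dOp Complex.I (dOp (-Complex.I) (dOp Complex.I α))) = 0 := fun hα => by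
    rw [anti (hα.dOp _), dOp_dOp_self hα, dOp_zero, map_zero, neg_zero]
  have ev : ∀ {n : ℕ}, Even n → ∀ α : CForm X n, symbol α ∈ Subalgebra.center ℂ (X → ExtAlg) :=
    fun hn α => symbol_mem_center hn α
  have hW' : W = w + Complex.I • symbol (dOp (-Complex.I) (dOp Complex.I (ofReal φ))) := by
    rw [hW, hw, deform_eq, map_add, map_smul]
  subst hf hg hw hk ha hb hp hq hA hB
  -- The `4`-form `m = ∂∂̄Ω` is given explicitly because it occurs only on the right-hand side of
  -- the identity.
  rw [energy_deriv_sub_eq (ev Even.zero _) (ev Even.zero _) (ev (by decide) _) (ev (by decide) _)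
    (ev (by decide) _) (ev (by decide) (dOp (-Complex.I) (dOp Complex.I Ω)))
    (fun x => ∃ (n : ℕ) (α : CForm X n), Odd n ∧ x = symbol α) ?_ ⟨_, _, by decide, rfl⟩
    ⟨_, _, by decide, rfl⟩ ⟨_, _, by decide, rfl⟩ ⟨_, _, by decide, rfl⟩ ⟨_, _, by decide, rfl⟩
    ⟨_, _, by decide, rfl⟩ hW']
  · have sa := sφ.dOp (-Complex.I)
    have sb := sφ.dOp Complex.I
    have sp := sψ.dOp (-Complex.I)
    have sq := sψ.dOp Complex.I
    have sh := sb.dOp (-Complex.I)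
    have sk := sq.dOp (-Complex.I)
    have sA := hΩ.dOp (-Complex.I)
    have sB := hΩ.dOp Complex.I
    have efwwpb := symbolIntegral_dOp_two_two_one Complex.I hφ hΩ hΩ sp
      rfl rfl rfl (anti sψ)
    have efwhpb := symbolIntegral_dOp_two_two_one Complex.I hφ hΩ sh sp
      rfl rfl (self' sφ) (anti sψ)
    have efwkab := symbolIntegral_dOp_two_two_one Complex.I hφ hΩ sk sa
      rfl rfl (self' sψ) (anti sφ)
    have efapBb := symbolIntegral_dOp_one_one_three Complex.I hφ sa sp sB
      rfl (anti sφ) (anti sψ) (self _ hΩ)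
    have efaqAb := symbolIntegral_dOp_one_one_three Complex.I hφ sa sq sA
      rfl (anti sφ) (self _ sψ) (anti hΩ)
    have egwwab := symbolIntegral_dOp_two_two_one Complex.I hψ hΩ hΩ sa
      rfl rfl rfl (anti sφ)
    have egwhab := symbolIntegral_dOp_two_two_one Complex.I hψ hΩ sh sa
      rfl rfl (self' sφ) (anti sφ)
    have eghhab := symbolIntegral_dOp_two_two_one Complex.I hψ sh sh sa
      rfl (self' sφ) (self' sφ) (anti sφ)
    have efwwq := symbolIntegral_dOp_two_two_one (-Complex.I) hφ hΩ hΩ sq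
      rfl rfl rfl rfl
    have efwhq := symbolIntegral_dOp_two_two_one (-Complex.I) hφ hΩ sh sq
      rfl rfl (self _ (sφ.dOp _)) rfl
    have efwkb := symbolIntegral_dOp_two_two_one (-Complex.I) hφ hΩ sk sb
      rfl rfl (self _ (sψ.dOp _)) rfl
    have efhhq := symbolIntegral_dOp_two_two_one (-Complex.I) hφ sh sh sq
      rfl (self _ (sφ.dOp _)) (self _ (sφ.dOp _)) rfl
    have efaqB := symbolIntegral_dOp_one_one_three (-Complex.I) hφ sa sq sB
      rfl (self _ sφ) rfl rfl
    have egwwb := symbolIntegral_dOp_two_two_one (-Complex.I) hψ hΩ hΩ sb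
      rfl rfl rfl rfl
    have egwhb := symbolIntegral_dOp_two_two_one (-Complex.I) hψ hΩ sh sb
      rfl rfl (self _ (sφ.dOp _)) rfl
    -- Each of the fifteen exact terms lies in the kernel of the integral, hence so does their
    -- combination.
    let K := LinearMap.ker (symbolIntegral X)
    exact (K.add_mem
      (K.sub_mem
      (K.sub_mem
      (K.sub_mem
      (K.add_mem
      (K.sub_mem
      (K.add_mem
      (K.sub_mem
      (K.sub_mem
      (K.add_mem
      (K.sub_mem
      (K.add_mem
      (K.add_mem
      (K.add_mem
      (K.smul_mem _ efwwpb) (K.smul_mem _ efwhpb)) (K.smul_mem _ efwkab)) (K.smul_mem _ efapBb)) (K.smul_mem _ efaqAb)) (K.smul_mem _ egwwab)) (K.smul_mem _ egwhab)) (K.smul_mem _ eghhab)) (K.smul_mem _ efwwq)) (K.smul_mem _ efwhq)) (K.smul_mem _ efwkb)) (K.smul_mem _ efhhq)) (K.smul_mem _ efaqB)) (K.smul_mem _ egwwb)) (K.smul_mem _ egwhb))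
  · rintro _ _ ⟨n, α, hn, rfl⟩ ⟨l, β, hl, rfl⟩
    exact symbol_anticomm hn hl α β

end Slice

end CForm

end

/-! ### Integration in time, and families of wedge powers. -/

noncomputable section

open MeasureTheory

/-- `v` is integrable on `[0,1]` and its integral is the increment of `u`. -/
structure IsPrimitive (u v : ℝ → ℂ) : Prop where
  intervalIntegrable : IntervalIntegrable v volume 0 1
  integral_eq : ∫ t in (0 : ℝ)..1, v t = u 1 - u 0

theorem IsPrimitive.add {u v u' v' : ℝ → ℂ} (h : IsPrimitive u v) (h' : IsPrimitive u' v') :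
    IsPrimitive (fun t => u t + u' t) fun t => v t + v' t :=
  ⟨h.1.add h'.1, by
    rw [intervalIntegral.integral_add h.1 h'.1, h.2, h'.2]; ring⟩

theorem IsPrimitive.sub {u v u' v' : ℝ → ℂ} (h : IsPrimitive u v) (h' : IsPrimitive u' v') :
    IsPrimitive (fun t => u t - u' t) fun t => v t - v' t :=
  ⟨h.1.sub h'.1, by
    rw [intervalIntegral.integral_sub h.1 h'.1, h.2, h'.2]; ring⟩

theorem IsPrimitive.const_mul {u v : ℝ → ℂ} (c : ℂ) (h : IsPrimitive u v) :
    IsPrimitive (fun t => c * u t) fun t => c * v t :=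
  ⟨h.1.const_mul c, by
    rw [intervalIntegral.integral_const_mul, h.2]; ring⟩

theorem IsPrimitive.sum {ι : Type*} [Fintype ι] {u v : ι → ℝ → ℂ} (h : ∀ i, IsPrimitive (u i) (v i)) :
    IsPrimitive (fun t => ∑ i, u i t) fun t => ∑ i, v i t :=
  ⟨by
    have h1 := IntervalIntegrable.sum Finset.univ fun i _ => (h i).1
    rwa [show ∑ i, v i = fun t => ∑ i, v i t from funext fun t => Finset.sum_apply t _ v] at h1, by
    rw [intervalIntegral.integral_finsetSum fun i _ => (h i).1, ← Finset.sum_sub_distrib]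
    exact Finset.sum_congr rfl fun i _ => (h i).2⟩

theorem IsPrimitive.congr {u v w : ℝ → ℂ} (h : IsPrimitive u v)
    (hw : ∀ t ∈ Set.Icc (0 : ℝ) 1, v t = w t) : IsPrimitive u w := by
  refine ⟨h.1.congr fun t ht => ?_, ?_⟩
  · rw [Set.uIoc_of_le zero_le_one] at ht
    exact hw t (Set.Ioc_subset_Icc_self ht)
  · rw [← h.2]
    refine intervalIntegral.integral_congr fun t ht => ?_
    rw [Set.uIcc_of_le zero_le_one] at ht
    exact (hw t ht).symm

namespace CForm

section WedgePower

variable {X : Type*}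

/-- The derivative of `α ^ i` in the direction `α'`. -/
def wpowDeriv (α α' : CForm X 2) : (i : ℕ) → CForm X (2 * i)
  | 0 => 0
  | i + 1 => (α.wpow i ⋏ α' : CForm X (2 * i + 2)) + wpowDeriv α α' i ⋏ α

theorem symbol_wpowDeriv (α α' : CForm X 2) (i : ℕ) :
    symbol (wpowDeriv α α' i) = powDeriv (symbol α) (symbol α') i := by
  induction i with
  | zero => exact map_zero symbol
  | succ i ih =>
    rw [powDeriv, ← ih, ← symbol_wpow, ← symbol_wedge, ← symbol_wedge, ← map_add]
    rfl

theorem symbol_fmul_ofReal (f : X → ℝ) (α : CForm X k) :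
    symbol (α.fmul f) = symbol (ofReal f) * symbol α := symbol_fmul f α

end WedgePower

/-! ### The closed formula as a primitive of the integrand along a path. -/

section Path

variable {X : Type*} [TopologicalSpace X] [ChartedSpace C3 X] {k l : ℕ}

theorem HasTimeDeriv.congr {α α' β' : ℝ → CForm X k} (h : HasTimeDeriv α α')
    (he : ∀ t, α' t = β' t) : HasTimeDeriv α β' := by
  rwa [show β' = α' from funext fun t => (he t).symm]

theorem HasTimeDeriv.wedge_const {α α' : ℝ → CForm X k} {β : CForm X l} (h : HasTimeDeriv α α')
    (hβ : β.IsSmooth) : HasTimeDeriv (fun t => α t ⋏ β) fun t => α' t ⋏ β :=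
  (h.wedge (HasTimeDeriv.const hβ)).congr fun t => symbol_injective <| by
    simp only [map_add, symbol_wedge, map_zero, mul_zero, zero_add]

theorem HasTimeDeriv.wpow {α α' : ℝ → CForm X 2} (h : HasTimeDeriv α α') (i : ℕ) :
    HasTimeDeriv (fun t => (α t).wpow i) fun t => wpowDeriv (α t) (α' t) i := by
  induction i with
  | zero => exact HasTimeDeriv.const isSmooth_one
  | succ i ih => exact ih.wedge h

theorem IsSmooth.wpow {α : CForm X 2} (h : α.IsSmooth) (i : ℕ) : (α.wpow i).IsSmooth :=
  isSmooth_of_family ((HasTimeDeriv.const h).wpow i).smooth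

theorem hasTimeDeriv_ofReal {Φ Ψ : ℝ → X → ℝ} (h : HasTimeDerivFun Φ Ψ) :
    HasTimeDeriv (fun t => ofReal (Φ t)) fun t => ofReal (Ψ t) := h.ofFun

variable [IsManifold 𝓘(ℂ, C3) ω X]

theorem hasTimeDerivFun_pathDeriv {Ω : CForm X 2} {φ' φ'' : X → ℝ} {Φ : ℝ → X → ℝ}
    (h : IsSmoothPath Ω φ' φ'' Φ) : HasTimeDerivFun Φ (pathDeriv Φ) := by
  have hs := isSmoothFunFamily_of_contMDiffOn h.1
  refine ⟨hs, fun c => contDiffOn_derivWithin_slice (chartAt C3 c).open_target (hs c),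
    fun t ht x => ?_⟩
  have hp : (t, chartAt C3 x x) ∈ Set.Icc (0 : ℝ) 1 ×ˢ (chartAt C3 x).target :=
    ⟨ht, mem_chart_target C3 x⟩
  have h1 := (hasDerivWithinAt_slice hp (((hs x).differentiableOn (by simp)) _ hp))
  simp only [(chartAt C3 x).left_inv (mem_chart_source C3 x)] at h1
  exact h1.differentiableWithinAt.hasDerivWithinAt

theorem hasTimeDeriv_del₀ {Φ Ψ : ℝ → X → ℝ} (h : HasTimeDerivFun Φ Ψ) :
    HasTimeDeriv (fun t => del₀ (Φ t)) fun t => del₀ (Ψ t) := by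
  simpa only [del₀_eq] using (hasTimeDeriv_ofReal h).dOp (-Complex.I)

theorem hasTimeDeriv_delbar₀ {Φ Ψ : ℝ → X → ℝ} (h : HasTimeDerivFun Φ Ψ) :
    HasTimeDeriv (fun t => delbar₀ (Φ t)) fun t => delbar₀ (Ψ t) := by
  simpa only [delbar₀_eq] using (hasTimeDeriv_ofReal h).dOp Complex.I

theorem hasTimeDeriv_deform {Ω : CForm X 2} (hΩ : Ω.IsSmooth) {Φ Ψ : ℝ → X → ℝ}
    (h : HasTimeDerivFun Φ Ψ) : HasTimeDeriv (fun t => deform Ω (Φ t))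
      fun t => Complex.I • dOp (-Complex.I) (dOp Complex.I (ofReal (Ψ t))) := by
  have h1 := (HasTimeDeriv.const hΩ).add
    ((((hasTimeDeriv_ofReal h).dOp Complex.I).dOp (-Complex.I)).smul Complex.I)
  simp only [deform_eq]
  exact h1.congr fun t => zero_add _

theorem isSmooth_del {α : CForm X k} (h : α.IsSmooth) : α.del.IsSmooth := by
  rw [del_eq_dOp]; exact h.dOp _

theorem isSmooth_delbar {α : CForm X k} (h : α.IsSmooth) : α.delbar.IsSmooth := by
  rw [delbar_eq_dOp]; exact h.dOp _

theorem isSmoothFamily_pathDeriv {Φ Ψ : ℝ → X → ℝ} (h : HasTimeDerivFun Φ Ψ) :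
    (IsSmoothFamily fun t => del₀ (Ψ t)) ∧ IsSmoothFamily fun t => delbar₀ (Ψ t) :=
  ⟨(hasTimeDeriv_del₀ h).smooth', (hasTimeDeriv_delbar₀ h).smooth'⟩

variable [T2Space X] [CompactSpace X]

/-- The derivative is expressed through the symbol, so that the time derivatives of all terms of the
closed formula can be collected in one ring. -/
theorem HasTimeDeriv.isPrimitive {α α' : ℝ → CForm X k} (h : HasTimeDeriv α α') (hk : k = 6) :
    IsPrimitive (fun t => (α t).integral hk) fun t => symbolIntegral X (symbol (α' t)) := by
  subst hk
  refine IsPrimitive.congr ⟨h.smooth'.intervalIntegrable_integral, h.integral_eq_sub⟩ fun t ht => ?_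
  exact integral_eq_symbolIntegral (h.smooth'.isSmooth ht) rfl

theorem IsSmoothFamily.intervalIntegrable {α : ℝ → CForm X k} (h : IsSmoothFamily α)
    (hk : k = 6) : IntervalIntegrable (fun t => (α t).integral hk) volume 0 1 := by
  subst hk
  exact h.intervalIntegrable_integral

theorem integral_fmul_zero (α : CForm X k) (hk : k = 6) :
    (α.fmul 0).integral hk = 0 := by
  subst hk
  have h : α.fmul 0 = (0 : ℂ) • α := funext fun x => by
    change ((0 : ℝ) : ℂ) • α x = (0 : ℂ) • α x
    rw [Complex.ofReal_zero]
  rw [h, integral_smul, zero_mul]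

/-- Four times the closed formula, without the normalising factor. -/
def energy (Ω : CForm X 2) (φ : X → ℝ) : ℂ :=
  ∑ i : Fin 4, (((deform Ω φ).wpow i ⋏ Ω.wpow (3 - (i : ℕ))).fmul φ).integral
    - 2 * ∑ i : Fin 2, ((i : ℕ) + 1 : ℂ) *
        (((deform Ω φ).wpow i ⋏ Ω.wpow (1 - (i : ℕ)) ⋏ (Complex.I • Ω.del) ⋏ delbar₀ φ).fmul φ).integral
    + 2 * ∑ i : Fin 2, ((i : ℕ) + 1 : ℂ) *
        (((deform Ω φ).wpow i ⋏ Ω.wpow (1 - (i : ℕ)) ⋏ (Complex.I • Ω.delbar) ⋏ del₀ φ).fmul φ).integral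

/-- The factor `1/V` is split off, so the main identity is proved without it and `V ≠ 0` is never
needed. -/
theorem mabuchiFormula_eq (Ω : CForm X 2) (φ : X → ℝ) :
    mabuchiFormula Ω φ = (totalVolume Ω)⁻¹ * (energy Ω φ / 4) := by
  simp only [mabuchiFormula, energy, Fin.sum_univ_two, div_eq_mul_inv, mul_inv, one_mul]
  ring

theorem energy_zero (Ω : CForm X 2) : energy Ω 0 = 0 := by
  simp only [energy, integral_fmul_zero, Finset.sum_const_zero, mul_zero, sub_zero, add_zero]

/-- The integrand of the functional. -/
def integrand (Ω : CForm X 2) (φ ψ : X → ℝ) : ℂ :=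
  (((deform Ω φ).wpow 3).fmul ψ).integral
    - ((3 * Complex.I) • (Ω.del ⋏ (delbar₀ ψ).fmul φ ⋏ deform Ω φ)).integral
    + ((3 * Complex.I) • (Ω.delbar ⋏ (del₀ ψ).fmul φ ⋏ deform Ω φ)).integral
    + (del₀ φ ⋏ delbar₀ φ ⋏ Ω.del ⋏ delbar₀ ψ).integral
    + (delbar₀ φ ⋏ del₀ φ ⋏ Ω.delbar ⋏ del₀ ψ).integral

/-- Splitting the time integral requires each of the five terms to be integrable, which follows from
joint smoothness on `[0,1] × X`. -/
theorem mabuchiAlong_one_eq {Ω : CForm X 2} (hΩ : Ω.IsSmooth) {Φ : ℝ → X → ℝ}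
    (h : HasTimeDerivFun Φ (pathDeriv Φ)) :
    mabuchiAlong 1 Ω Φ = (totalVolume Ω)⁻¹ * ∫ t in (0 : ℝ)..1, integrand Ω (Φ t) (pathDeriv Φ t) := by
  have hD := (hasTimeDeriv_deform hΩ h).smooth
  have ha := (hasTimeDeriv_del₀ h).smooth
  have hb := (hasTimeDeriv_delbar₀ h).smooth
  obtain ⟨hp, hq⟩ := isSmoothFamily_pathDeriv h
  have hA := (isSmooth_del hΩ).family
  have hB := (isSmooth_delbar hΩ).family
  have i1 := (h.smooth'.fmul ((hasTimeDeriv_deform hΩ h).wpow 3).smooth).intervalIntegrable rfl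
  have i2 := (((hA.wedge (h.smooth.fmul hq)).wedge hD).smul (3 * Complex.I)).intervalIntegrable rfl
  have i3 := (((hB.wedge (h.smooth.fmul hp)).wedge hD).smul (3 * Complex.I)).intervalIntegrable rfl
  have i4 := (((ha.wedge hb).wedge hA).wedge hq).intervalIntegrable rfl
  have i5 := (((hb.wedge ha).wedge hB).wedge hp).intervalIntegrable rfl
  have e := intervalIntegral.integral_add (((i1.sub i2).add i3).add i4) i5
  have e1 := intervalIntegral.integral_add ((i1.sub i2).add i3) i4
  have e2 := intervalIntegral.integral_add (i1.sub i2) i3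
  have e3 := intervalIntegral.integral_sub i1 i2
  have e' : (∫ t in (0 : ℝ)..1, integrand Ω (Φ t) (pathDeriv Φ t)) = _ := e
  rw [e', e1, e2, e3, mabuchiAlong]
  ring

theorem integrand_eq {Ω : CForm X 2} (hΩ : Ω.IsSmooth) {φ ψ : X → ℝ}
    (hφ : IsSmoothFunFamily fun _ => φ) (hψ : IsSmoothFunFamily fun _ => ψ) :
    integrand Ω φ ψ = symbolIntegral X (symbol (ofReal ψ) * symbol (deform Ω φ) ^ 3 -
        (3 * Complex.I) • (symbol Ω.del * (symbol (ofReal φ) * symbol (delbar₀ ψ)) *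
          symbol (deform Ω φ)) +
        (3 * Complex.I) • (symbol Ω.delbar * (symbol (ofReal φ) * symbol (del₀ ψ)) *
          symbol (deform Ω φ)) +
        symbol (del₀ φ) * symbol (delbar₀ φ) * symbol Ω.del * symbol (delbar₀ ψ) +
        symbol (delbar₀ φ) * symbol (del₀ φ) * symbol Ω.delbar * symbol (del₀ ψ)) := by
  have sd : ∀ {f : X → ℝ}, (IsSmoothFunFamily fun _ => f) → (del₀ f).IsSmooth := fun hf =>
    isSmooth_del (isSmooth_ofReal hf)
  have sb : ∀ {f : X → ℝ}, (IsSmoothFunFamily fun _ => f) → (delbar₀ f).IsSmooth := fun hf =>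
    isSmooth_delbar (isSmooth_ofReal hf)
  have sD : (deform Ω φ).IsSmooth := isSmooth_of_family
    (hΩ.family.add ((isSmooth_del (sb hφ)).family.smul Complex.I))
  have sA := isSmooth_del hΩ
  have sB := isSmooth_delbar hΩ
  rw [integrand, integral_eq_symbolIntegral (isSmooth_fmul_of_family hψ (sD.wpow 3)),
    integral_eq_symbolIntegral (isSmooth_of_family
      (((sA.wedge (isSmooth_fmul_of_family hφ (sb hψ))).wedge sD).family.smul _)),
    integral_eq_symbolIntegral (isSmooth_of_family
      (((sB.wedge (isSmooth_fmul_of_family hφ (sd hψ))).wedge sD).family.smul _)),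
    integral_eq_symbolIntegral ((((sd hφ).wedge (sb hφ)).wedge sA).wedge (sb hψ)),
    integral_eq_symbolIntegral ((((sb hφ).wedge (sd hφ)).wedge sB).wedge (sd hψ))]
  simp only [map_add, map_sub, map_smul, symbol_wedge, symbol_fmul_ofReal, symbol_wpow]

set_option maxHeartbeats 1000000 in
/-- The derivative of the closed formula along a path. -/
theorem isPrimitive_energy {Ω : CForm X 2} (hΩ : Ω.IsSmooth) {Φ Ψ : ℝ → X → ℝ}
    (h : HasTimeDerivFun Φ Ψ) :
    IsPrimitive (fun t => energy Ω (Φ t)) fun t => 4 * integrand Ω (Φ t) (Ψ t) := by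
  have hD := hasTimeDeriv_deform hΩ h
  have ha := hasTimeDeriv_del₀ h
  have hb := hasTimeDeriv_delbar₀ h
  have sA : (Complex.I • Ω.del).IsSmooth :=
    isSmooth_of_family ((isSmooth_del hΩ).family.smul Complex.I)
  have sB : (Complex.I • Ω.delbar).IsSmooth :=
    isSmooth_of_family ((isSmooth_delbar hΩ).family.smul Complex.I)
  -- `p1`, `p2`, `p3` differentiate the three sums of the closed formula term by term, by the
  -- product rule.
  have p1 := fun i : Fin 4 => (h.fmul ((hD.wpow i).wedge_const
    (hΩ.wpow (3 - (i : ℕ))))).isPrimitive (by omega)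
  have p2 := fun i : Fin 2 => ((h.fmul ((((hD.wpow i).wedge_const
    (hΩ.wpow (1 - (i : ℕ)))).wedge_const sA).wedge hb)).isPrimitive (by omega)).const_mul
      ((i : ℕ) + 1 : ℂ)
  have p3 := fun i : Fin 2 => ((h.fmul ((((hD.wpow i).wedge_const
    (hΩ.wpow (1 - (i : ℕ)))).wedge_const sB).wedge ha)).isPrimitive (by omega)).const_mul
      ((i : ℕ) + 1 : ℂ)
  refine (((IsPrimitive.sum p1).sub ((IsPrimitive.sum p2).const_mul 2)).add
    ((IsPrimitive.sum p3).const_mul 2)).congr fun t ht => ?_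
  have hφ := h.smooth.slice ht
  have hψ := h.smooth'.slice ht
  -- The symbol of the derivative and that of four times the integrand have the same integral; what
  -- remains is to match the order of summands in the product rule.
  have key := symbolIntegral_energy_deriv hΩ hφ hψ rfl rfl rfl rfl rfl
    (congrArg symbol (del₀_eq _)) (congrArg symbol (delbar₀_eq _)) (congrArg symbol (del₀_eq _))
    (congrArg symbol (delbar₀_eq _)) (congrArg symbol (del_eq_dOp Ω))
    (congrArg symbol (delbar_eq_dOp Ω))
  rw [map_sub, map_smul, sub_eq_zero, ← integrand_eq hΩ hφ hψ, smul_eq_mul] at key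
  rw [← key, map_add, map_sub, map_smul, map_smul, map_sum, map_sum, map_sum]
  simp only [map_smul, smul_eq_mul]
  simp only [map_add, symbol_fmul_ofReal, symbol_wedge, symbol_wpow, symbol_wpowDeriv, map_smul]
  refine congrArg₂ _ (congrArg₂ _ (Finset.sum_congr rfl fun i _ => add_comm _ _)
    (congrArg _ (Finset.sum_congr rfl fun i _ => congrArg _ (add_comm _ _))))
    (congrArg _ (Finset.sum_congr rfl fun i _ => congrArg _ (add_comm _ _)))

end Path

end CForm

end

/-! ### The segment from `0` to `φ`, and the conclusion. -/

noncomputable section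

open MeasureTheory

namespace CForm

section LinearPath

variable {X : Type*}

/-- Applied to `Ω` and `Ω_φ`, whose convex combinations are the forms `Ω_{tφ}`. -/
theorem IsPositive.convex {α β : CForm X 2} (hα : α.IsPositive) (hβ : β.IsPositive) {t : ℝ}
    (ht : t ∈ Set.Icc (0 : ℝ) 1) :
    (((1 - t : ℝ) : ℂ) • α + (t : ℂ) • β : CForm X 2).IsPositive := fun x => by
  obtain ⟨a1, a2, a3⟩ := hα x
  obtain ⟨b1, b2, b3⟩ := hβ x
  have he : ∀ v : Fin 2 → C3, (((1 - t : ℝ) : ℂ) • α + (t : ℂ) • β : CForm X 2) x v =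
      ((1 - t : ℝ) : ℂ) * α x v + (t : ℂ) * β x v := fun v => rfl
  refine ⟨fun v w => ?_, fun v w => ?_, fun v hv => ?_⟩
  · rw [he, Complex.add_im, Complex.im_ofReal_mul, Complex.im_ofReal_mul, a1, b1, mul_zero,
      mul_zero, add_zero]
  · rw [he, he, a2, b2]
  · rw [he, Complex.add_re, Complex.re_ofReal_mul, Complex.re_ofReal_mul]
    -- Strict positivity comes from `α` when `t = 0` and from `β` when `t > 0`.
    rcases eq_or_lt_of_le ht.1 with h | h
    · rw [← h]
      simpa using a3 v hv
    · exact add_pos_of_nonneg_of_pos (mul_nonneg (sub_nonneg.2 ht.2) (a3 v hv).le)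
        (mul_pos h (b3 v hv))

theorem pathDeriv_linear (φ : X → ℝ) {t : ℝ} (ht : t ∈ Set.Icc (0 : ℝ) 1) :
    pathDeriv (fun t x => t * φ x) t = φ := funext fun x => by
  have h := ((hasDerivAt_id t).mul_const (φ x)).hasDerivWithinAt (s := Set.Icc (0 : ℝ) 1)
  rw [one_mul] at h
  exact h.derivWithin (uniqueDiffOn_Icc zero_lt_one _ ht)

theorem ofReal_const_mul (t : ℝ) (f : X → ℝ) : ofReal (fun x => t * f x) = (t : ℂ) • ofReal f := by
  refine symbol_injective (funext fun x => ?_)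
  rw [map_smul]
  change symb (ContinuousAlternatingMap.constOfIsEmpty ℝ C3 (Fin 0) _) =
    (t : ℂ) • symb (ContinuousAlternatingMap.constOfIsEmpty ℝ C3 (Fin 0) _)
  rw [symb_constOfIsEmpty, symb_constOfIsEmpty, Algebra.smul_def, ← map_mul]
  exact congrArg _ (Complex.ofReal_mul t (f x))

variable [TopologicalSpace X] [ChartedSpace C3 X]

theorem del₀_const_mul (t : ℝ) (f : X → ℝ) : del₀ (fun x => t * f x) = (t : ℂ) • del₀ f := by
  rw [del₀_eq, del₀_eq, ofReal_const_mul, dOp_smul]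

theorem delbar₀_const_mul (t : ℝ) (f : X → ℝ) :
    delbar₀ (fun x => t * f x) = (t : ℂ) • delbar₀ f := by
  rw [delbar₀_eq, delbar₀_eq, ofReal_const_mul, dOp_smul]

theorem deform_const_mul (Ω : CForm X 2) (t : ℝ) (f : X → ℝ) :
    deform Ω (fun x => t * f x) = ((1 - t : ℝ) : ℂ) • Ω + (t : ℂ) • deform Ω f := by
  rw [deform_eq, deform_eq, ofReal_const_mul, dOp_smul, dOp_smul]
  push_cast
  module

theorem isSmoothPath_linear {Ω : CForm X 2} (hpos : Ω.IsPositive) {φ : X → ℝ}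
    (hφ : φ ∈ potentials Ω) : IsSmoothPath Ω 0 φ fun t x => t * φ x := by
  refine ⟨?_, funext fun x => zero_mul _, funext fun x => one_mul _, fun t ht => ⟨?_, ?_⟩⟩
  · have h1 : ContMDiff (𝓘(ℝ, ℝ).prod 𝓘(ℝ, C3)) 𝓘(ℝ, ℝ) ∞ fun p : ℝ × X => p.1 := contMDiff_fst
    have h2 : ContMDiff (𝓘(ℝ, ℝ).prod 𝓘(ℝ, C3)) 𝓘(ℝ, ℝ) ∞ fun p : ℝ × X => φ p.2 :=
      hφ.1.comp contMDiff_snd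
    exact (h1.smul h2).contMDiffOn
  · have h1 : ContMDiff 𝓘(ℝ, C3) 𝓘(ℝ, ℝ) ∞ fun _ : X => t := contMDiff_const
    exact h1.smul hφ.1
  · rw [deform_const_mul]
    exact hpos.convex hφ.2 ht

variable [IsManifold 𝓘(ℂ, C3) ω X] [T2Space X] [CompactSpace X]

theorem integral_eq_zero_of_symbol {k : ℕ} {α : CForm X k} (h : symbol α = 0) (hk : k = 6) :
    α.integral hk = 0 := by
  subst hk
  have h1 : α = (0 : ℂ) • α := symbol_injective (by rw [map_smul, h, smul_zero])
  rw [h1, integral_smul, zero_mul]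

/-- Moving `β` past the odd form `γ` produces `β ∧ β = 0`. -/
theorem integral_wedge_self_eq_zero (c : ℂ) (α β : CForm X 1) (γ : CForm X 3) :
    (α ⋏ (c • β) ⋏ γ ⋏ β).integral = 0 := by
  refine integral_eq_zero_of_symbol ?_ _
  rw [symbol_wedge, symbol_wedge, symbol_wedge, map_smul, mul_assoc,
    symbol_anticomm (by decide) (by decide) γ β, mul_neg, mul_assoc, ← mul_assoc (c • symbol β),
    smul_mul_assoc, symbol_mul_self (by decide), smul_zero, zero_mul, mul_zero, neg_zero]

/-- On the segment `∂̄φ_t` and `∂̄φ̇_t` are proportional, and likewise `∂φ_t` and `∂φ̇_t`, so both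
`ε`-integrands vanish identically. -/
theorem mabuchiAlong_linear (ε : ℂ) (Ω : CForm X 2) (φ : X → ℝ) :
    mabuchiAlong ε Ω (fun t x => t * φ x) = mabuchiAlong 0 Ω fun t x => t * φ x := by
  have h1 : (∫ t in (0 : ℝ)..1, (del₀ (fun x => t * φ x) ⋏ delbar₀ (fun x => t * φ x) ⋏ Ω.del ⋏
      delbar₀ (pathDeriv (fun t x => t * φ x) t)).integral) = ∫ t in (0 : ℝ)..1, (0 : ℂ) := by
    refine intervalIntegral.integral_congr fun t ht => ?_
    rw [Set.uIcc_of_le zero_le_one] at ht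
    simp only [pathDeriv_linear φ ht, delbar₀_const_mul, integral_wedge_self_eq_zero]
  have h2 : (∫ t in (0 : ℝ)..1, (delbar₀ (fun x => t * φ x) ⋏ del₀ (fun x => t * φ x) ⋏ Ω.delbar ⋏
      del₀ (pathDeriv (fun t x => t * φ x) t)).integral) = ∫ t in (0 : ℝ)..1, (0 : ℂ) := by
    refine intervalIntegral.integral_congr fun t ht => ?_
    rw [Set.uIcc_of_le zero_le_one] at ht
    simp only [pathDeriv_linear φ ht, del₀_const_mul, integral_wedge_self_eq_zero]
  rw [intervalIntegral.integral_zero] at h1 h2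
  simp only [mabuchiAlong, h1, h2, mul_zero]

theorem mabuchiAlong_one_eq_mabuchiFormula {Ω : CForm X 2} (hΩ : Ω.IsSmooth) {φ : X → ℝ}
    {Φ : ℝ → X → ℝ} (h : IsSmoothPath Ω 0 φ Φ) : mabuchiAlong 1 Ω Φ = mabuchiFormula Ω φ := by
  have hd := hasTimeDerivFun_pathDeriv h
  have e := (isPrimitive_energy hΩ hd).integral_eq
  rw [intervalIntegral.integral_const_mul, h.2.1, h.2.2.1, energy_zero, sub_zero] at e
  rw [mabuchiAlong_one_eq hΩ hd, mabuchiFormula_eq, ← e]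
  ring

end LinearPath

end CForm

end

theorem corollary1p2 {X : Type*} [TopologicalSpace X] [ChartedSpace C3 X]
    [IsManifold 𝓘(ℂ, C3) ω X] [T2Space X] [CompactSpace X]
    (Ω : CForm X 2) (hΩ : Ω.IsSmooth) (hpos : Ω.IsPositive)
    (φ : X → ℝ) (hφ : φ ∈ potentials Ω) :
    (∀ Φ : ℝ → X → ℝ, IsSmoothPath Ω 0 φ Φ → mabuchiAlong 1 Ω Φ = mabuchiFormula Ω φ) ∧
      IsSmoothPath Ω 0 φ (fun t x => t * φ x) ∧
      mabuchiAlong (-1) Ω (fun t x => t * φ x) = mabuchiFormula Ω φ := by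
  have hlin := CForm.isSmoothPath_linear hpos hφ
  refine ⟨fun Φ h => CForm.mabuchiAlong_one_eq_mabuchiFormula hΩ h, hlin, ?_⟩
  -- On the segment the coefficient passes from `-1` to `0` and then from `0` to `1`, where the
  -- first claim applies.
  rw [CForm.mabuchiAlong_linear, ← CForm.mabuchiAlong_linear 1]
  exact CForm.mabuchiAlong_one_eq_mabuchiFormula hΩ hlin
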